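/- Let $d>1$ and let $G$ be a finite group of linear automorphisms of $\mathbb C^d$ that is generated by pseudo-reflections (elements $\sigma$ of finite order with $\operatorname{rank}(I-\sigma)=1$) and leaves the polydisc $\mathbb D^d$ invariant. Let $\theta=(\theta_1,\dots,\theta_d)$ be basic polynomials of $G$, i.e. algebraically independent generators of the algebra of $G$-invariant polynomials. Let $\mathcal A(\theta(\mathbb D^d))$ be the algebra of continuous functions on $\overline{\theta(\mathbb D^d)}$ that are holomorphic on $\theta(\mathbb D^d)$, with the supremum norm, and let $\partial\theta(\mathbb D^d)$ be its \v Silov boundary. Let $\rho$ be a one-dimensional representation of $G$, let $\ell_\rho$ be a homogeneous polynomial with $\ell_\rho\circ\sigma=\rho(\sigma)\ell_\rho$ for all $\sigma\in G$ such that every polynomial $f$ with $f\circ\sigma=\rho(\sigma)f$ for all $\sigma\in G$ is $\ell_\rho$ times a $G$-invariant polynomial, and let $\mu_{\rho,\theta}$ be the measure on $\partial\theta(\mathbb D^d)$ given by $$\int f\,d\mu_{\rho,\theta}=\frac1{|G|}\int_{\mathbb T^d}(f\circ\theta)\,|\ell_\rho|^2\,d\nu,$$ where $\nu$ is normalized Lebesgue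 measure on the torus $\mathbb T^d$. A Hilbert module over a topological algebra $\mathcal B$ is a complex Hilbert space $\mathcal H$ with a unital $\mathcal B$-module structure, compatible with complex scalars, such that $(b,h)\mapsto b\cdot h$ is continuous; module maps are bounded linear maps commuting with the action. A Hilbert module $\mathcal H$ over $\mathcal A(\theta(\mathbb D^d))$ is normal if for each $h\in\mathcal H$ the map $f\mapsto f\cdot h$ is continuous from the weak$^*$ topology of $L^\infty(\partial\theta(\mathbb D^d),\mu_{\rho,\theta})$, restricted to $\mathcal A(\theta(\mathbb D^d))$, to the weak topology of $\mathcal H$. Let $\mathfrak N$ be the category of normal Hilbert modules over $\mathcal A(\theta(\mathbb D^d))$ and module maps. For $\mathcal K,\mathcal H$ in $\mathfrak N$, $\operatorname{Ext}_{\mathfrak N}(\mathcal K,\mathcal H)$ is the set of equivalence classes of short exact sequences $0\to\mathcal H\to\mathcal J\to\mathcal K\to0$ in $\mathfrak N$ (two sequences, with middle terms $\mathcal J$ and $\mathcal J'$, are equivalent if there is a module map $\mathcal J\to\mathcal J'$ compatible with the identities of $\mathcal H$ and $\mathcal K$); its zero is the class of $0\to\mathcal H\to\mathcal H\oplus\mathcal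 K\to\mathcal K\to0$. An object $\mathcal P$ of $\mathfrak N$ is projective in $\mathfrak N$ if every short exact sequence $0\to\mathcal H\to\mathcal J\to\mathcal P\to0$ in $\mathfrak N$ splits. Let $\mathcal N$ be a Hilbert module over $C(\partial\theta(\mathbb D^d))$ that is normal when regarded, by restriction of functions to $\partial\theta(\mathbb D^d)$, as a Hilbert module over $\mathcal A(\theta(\mathbb D^d))$. Then for every normal Hilbert module $\mathcal K$ over $\mathcal A(\theta(\mathbb D^d))$, $$\operatorname{Ext}_{\mathfrak N}(\mathcal K,\mathcal N)=0\quad\text{and}\quad\operatorname{Ext}_{\mathfrak N}(\mathcal N,\mathcal K)=0.$$ Moreover, $\mathcal N$ is projective in $\mathfrak N$. -/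

import Mathlib

open MeasureTheory Topology

universe u v

noncomputable section

/-! ### Hilbert modules over a topological algebra of functions -/

/-- A Hilbert module over `A`: a complex Hilbert space with a (unital) `A`-module structure that is
compatible with the complex scalars and for which `(a, h) ↦ a • h` is jointly continuous. -/
structure HilbertModule (A : Type v) [CommRing A] [Algebra ℂ A] [TopologicalSpace A] where
  carrier : Type u
  [normedAddCommGroup : NormedAddCommGroup carrier]
  [innerProductSpace : InnerProductSpace ℂ carrier]
  [completeSpace : CompleteSpace carrier]
  [module : Module A carrier]
  [isScalarTower : IsScalarTower ℂ A carrier]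
  [continuousSMul : ContinuousSMul A carrier]

namespace HilbertModule

instance (A : Type v) [CommRing A] [Algebra ℂ A] [TopologicalSpace A] :
    CoeSort (HilbertModule.{u} A) (Type u) := ⟨HilbertModule.carrier⟩

attribute [instance] normedAddCommGroup innerProductSpace completeSpace module isScalarTower
  continuousSMul

variable {A : Type v} [CommRing A] [Algebra ℂ A] [TopologicalSpace A]

/-- Restriction of scalars of a Hilbert module along a continuous algebra homomorphism:
the same Hilbert space, with `a • h := φ a • h`. -/
def restrictScalars {B : Type*} [CommRing B] [Algebra ℂ B] [TopologicalSpace B]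
    (φ : A →ₐ[ℂ] B) (hφ : Continuous φ) (N : HilbertModule.{u} B) : HilbertModule.{u} A :=
  letI : Module A N := Module.compHom N φ.toRingHom
  { carrier := N
    isScalarTower := ⟨fun c a h => by
      change φ (c • a) • h = c • (φ a • h)
      rw [map_smul, smul_assoc]⟩
    continuousSMul := ⟨by
      change Continuous fun p : A × N => φ p.1 • p.2
      fun_prop⟩ }

/-- The Hilbert space direct sum `H ⊕ K` with the coordinatewise action. -/
def directSum (H K : HilbertModule.{u} A) : HilbertModule.{u} A where
  carrier := WithLp 2 (H × K)
  isScalarTower := ⟨fun c a h => by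
    apply WithLp.ofLp_injective
    simp [smul_assoc]⟩
  continuousSMul := ⟨by
    have h1 : Continuous fun p : A × WithLp 2 (H × K) => p.1 • p.2.ofLp :=
      continuous_fst.smul ((WithLp.prod_continuous_ofLp 2 H K).comp continuous_snd)
    exact (WithLp.prod_continuous_toLp 2 H K).comp h1⟩

/-- The inclusion `H → H ⊕ K`. Module maps are the continuous `A`-linear maps; they are
automatically complex linear. -/
def inl (H K : HilbertModule.{u} A) : H →L[A] directSum H K where
  toFun h := (WithLp.toLp 2 (h, 0) : WithLp 2 (H × K))
  map_add' x y := by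
    apply WithLp.ofLp_injective
    change (x + y, (0 : K)) = (x, 0) + (y, 0)
    simp
  map_smul' a x := by
    apply WithLp.ofLp_injective
    change (a • x, (0 : K)) = a • (x, 0)
    simp
  cont := (WithLp.prod_continuous_toLp 2 H K).comp (by fun_prop)

/-- The projection `H ⊕ K → K`. -/
def snd (H K : HilbertModule.{u} A) : directSum H K →L[A] K where
  toFun x := (WithLp.ofLp (p := 2) (V := H × K) x).2
  map_add' _ _ := rfl
  map_smul' _ _ := rfl
  cont := continuous_snd.comp (WithLp.prod_continuous_ofLp 2 H K)

end HilbertModule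

/-! ### Pseudo-reflection groups and basic polynomials -/

/-- A pseudo-reflection: `σ` has finite order and `id - σ` has rank one. -/
def IsPseudoReflection {d : ℕ} (σ : (Fin d → ℂ) ≃ₗ[ℂ] (Fin d → ℂ)) : Prop :=
  Module.finrank ℂ (LinearMap.range (LinearMap.id - σ.toLinearMap)) = 1 ∧ IsOfFinOrder σ

/-- A group generated by pseudo-reflections. -/
def IsPseudoReflectionGroup {d : ℕ} (G : Subgroup ((Fin d → ℂ) ≃ₗ[ℂ] (Fin d → ℂ))) : Prop :=
  Subgroup.closure {σ | σ ∈ G ∧ IsPseudoReflection σ} = G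

/-- The open unit polydisc. -/
def polydisc (d : ℕ) : Set (Fin d → ℂ) := {z | ∀ i, ‖z i‖ < 1}

/-- Polynomials with `f (σ z) = ρ(σ) f(z)` for all `σ ∈ G`. -/
def IsRelInvariant {d : ℕ} {G : Subgroup ((Fin d → ℂ) ≃ₗ[ℂ] (Fin d → ℂ))} (ρ : G →* ℂˣ)
    (f : MvPolynomial (Fin d) ℂ) : Prop :=
  ∀ (σ : G) (z : Fin d → ℂ),
    MvPolynomial.eval (σ.1 z) f = (ρ σ : ℂ) * MvPolynomial.eval z f

/-- `G`-invariant polynomials: the case of the trivial representation. -/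
def IsInvariantPoly {d : ℕ} (G : Subgroup ((Fin d → ℂ) ≃ₗ[ℂ] (Fin d → ℂ)))
    (f : MvPolynomial (Fin d) ℂ) : Prop :=
  IsRelInvariant (1 : G →* ℂˣ) f

/-- `θ` is a system of basic polynomials of `G`: algebraically independent generators of the
algebra of `G`-invariant polynomials. (They may, but need not, be homogeneous.) -/
def IsBasicPolynomials {d : ℕ} (G : Subgroup ((Fin d → ℂ) ≃ₗ[ℂ] (Fin d → ℂ)))
    (θ : Fin d → MvPolynomial (Fin d) ℂ) : Prop :=
  AlgebraicIndependent ℂ θ ∧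
    ∀ f, f ∈ Algebra.adjoin ℂ (Set.range θ) ↔ IsInvariantPoly G f

/-- `ℓ` is a polynomial `ℓ_ρ`: a homogeneous `ρ`-relative invariant such that every `ρ`-relative
invariant is `ℓ` times a `G`-invariant polynomial. -/
def IsRelInvariantGenerator {d : ℕ} {G : Subgroup ((Fin d → ℂ) ≃ₗ[ℂ] (Fin d → ℂ))}
    (ρ : G →* ℂˣ) (ℓ : MvPolynomial (Fin d) ℂ) : Prop :=
  (∃ n, ℓ.IsHomogeneous n) ∧ IsRelInvariant ρ ℓ ∧
    ∀ f, IsRelInvariant ρ f → ∃ g, IsInvariantPoly G g ∧ f = ℓ * g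

/-! ### The quotient domain, its algebra, its Šilov boundary and the measure on it -/

/-- The polynomial map `θ = (θ₁, …, θ_d)`. -/
def polyMap {d : ℕ} (θ : Fin d → MvPolynomial (Fin d) ℂ) (z : Fin d → ℂ) : Fin d → ℂ :=
  fun i => MvPolynomial.eval z (θ i)

/-- The quotient domain `θ(𝔻^d)`. -/
def quotientDomain {d : ℕ} (θ : Fin d → MvPolynomial (Fin d) ℂ) : Set (Fin d → ℂ) :=
  polyMap θ '' polydisc d

/-- The algebra `𝒜(D)` of continuous functions on `closure D` that are holomorphic on `D`. When
`closure D` is compact, the (compact-open) topology it carries is that of the supremum norm. -/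
def holAlgebra {d : ℕ} (D : Set (Fin d → ℂ)) : Subalgebra ℂ C(closure D, ℂ) where
  carrier := {f | ∃ g : (Fin d → ℂ) → ℂ, DifferentiableOn ℂ g D ∧
    ∀ (x : Fin d → ℂ) (hx : x ∈ D), f ⟨x, subset_closure hx⟩ = g x}
  mul_mem' := by
    rintro f₁ f₂ ⟨g₁, h₁, e₁⟩ ⟨g₂, h₂, e₂⟩
    exact ⟨g₁ * g₂, h₁.mul h₂, fun x hx => by simp [e₁ x hx, e₂ x hx]⟩
  add_mem' := by
    rintro f₁ f₂ ⟨g₁, h₁, e₁⟩ ⟨g₂, h₂, e₂⟩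
    exact ⟨g₁ + g₂, h₁.add h₂, fun x hx => by simp [e₁ x hx, e₂ x hx]⟩
  algebraMap_mem' c := ⟨fun _ => c, differentiableOn_const c, fun _ _ => rfl⟩

/-- The Šilov boundary of an algebra `A` of continuous functions on `X`: the intersection of all
closed sets on which every `f ∈ A` attains its maximum modulus. -/
def shilovBoundary {X : Type*} [TopologicalSpace X] (A : Subalgebra ℂ C(X, ℂ)) : Set X :=
  ⋂₀ {E | IsClosed E ∧ ∀ f ∈ A, ∃ y ∈ E, ∀ x, ‖f x‖ ≤ ‖f y‖}

/-- The Šilov boundary `∂θ(𝔻^d)` of the quotient domain. -/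
def quotientBoundary {d : ℕ} (θ : Fin d → MvPolynomial (Fin d) ℂ) :
    Set (closure (quotientDomain θ)) :=
  shilovBoundary (holAlgebra (quotientDomain θ))

/-- The restriction homomorphism `𝒜(θ(𝔻^d)) → C(∂θ(𝔻^d))`. -/
def restrictToBoundary {d : ℕ} (θ : Fin d → MvPolynomial (Fin d) ℂ) :
    holAlgebra (quotientDomain θ) →ₐ[ℂ] C(quotientBoundary θ, ℂ) :=
  (ContinuousMap.compRightAlgHom ℂ ℂ
    (⟨Subtype.val, continuous_subtype_val⟩ : C(quotientBoundary θ, closure (quotientDomain θ)))).comp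
    (holAlgebra (quotientDomain θ)).val

theorem continuous_restrictToBoundary {d : ℕ} (θ : Fin d → MvPolynomial (Fin d) ℂ) :
    Continuous (restrictToBoundary θ) :=
  (ContinuousMap.continuous_precomp
    (⟨Subtype.val, continuous_subtype_val⟩ : C(quotientBoundary θ, closure (quotientDomain θ)))).comp
    continuous_subtype_val

/-- The normalized Lebesgue (Haar) measure `ν` of the torus `𝕋^d`, as a measure on `ℂ^d`. -/
def torusMeasure (d : ℕ) : Measure (Fin d → ℂ) :=
  (ENNReal.ofReal ((2 * Real.pi) ^ d))⁻¹ •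
    Measure.map (torusMap 0 1)
      (volume.restrict (Set.Icc (0 : Fin d → ℝ) fun _ => 2 * Real.pi))

/-- The measure `μ_{ρ,θ}` on `∂θ(𝔻^d)`, where `ℓ = ℓ_ρ`:
`∫ f dμ_{ρ,θ} = |G|⁻¹ ∫ (f ∘ θ) |ℓ_ρ|² dν`. -/
def quotientMeasure {d : ℕ} (G : Subgroup ((Fin d → ℂ) ≃ₗ[ℂ] (Fin d → ℂ)))
    (θ : Fin d → MvPolynomial (Fin d) ℂ) (ℓ : MvPolynomial (Fin d) ℂ) :
    Measure (quotientBoundary θ) :=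
  Measure.comap (fun x : quotientBoundary θ => (x : Fin d → ℂ))
    ((Nat.card G : ENNReal)⁻¹ •
      Measure.map (polyMap θ)
        ((torusMeasure d).withDensity fun z => ‖MvPolynomial.eval z ℓ‖ₑ ^ 2))

/-- The restriction to `𝒜(θ(𝔻^d))` of the weak-* topology of `L^∞(∂θ(𝔻^d), μ_{ρ,θ})`: the coarsest
topology that makes `f ↦ ∫ f ψ dμ_{ρ,θ}` continuous for every `ψ ∈ L^1(∂θ(𝔻^d), μ_{ρ,θ})`. -/
def weakStarTopology {d : ℕ} (G : Subgroup ((Fin d → ℂ) ≃ₗ[ℂ] (Fin d → ℂ)))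
    (θ : Fin d → MvPolynomial (Fin d) ℂ) (ℓ : MvPolynomial (Fin d) ℂ) :
    TopologicalSpace (holAlgebra (quotientDomain θ)) :=
  TopologicalSpace.induced
    (fun (f : holAlgebra (quotientDomain θ)) (ψ : Lp ℂ 1 (quotientMeasure G θ ℓ)) =>
      ∫ x, restrictToBoundary θ f x * ψ x ∂(quotientMeasure G θ ℓ))
    inferInstance

/-- `H` is a normal Hilbert module over `𝒜(θ(𝔻^d))`: for every `h`, the orbit map `f ↦ f • h` is
continuous from the weak-* topology to the weak topology of the Hilbert space `H`. -/
def HilbertModule.IsNormal {d : ℕ} (G : Subgroup ((Fin d → ℂ) ≃ₗ[ℂ] (Fin d → ℂ)))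
    (θ : Fin d → MvPolynomial (Fin d) ℂ) (ℓ : MvPolynomial (Fin d) ℂ)
    (H : HilbertModule.{u} (holAlgebra (quotientDomain θ))) : Prop :=
  ∀ h : H, Continuous[weakStarTopology G θ ℓ, inferInstance]
    fun f : holAlgebra (quotientDomain θ) => toWeakSpace ℂ H (f • h)

theorem HilbertModule.IsNormal.directSum {d : ℕ} {G : Subgroup ((Fin d → ℂ) ≃ₗ[ℂ] (Fin d → ℂ))}
    {θ : Fin d → MvPolynomial (Fin d) ℂ} {ℓ : MvPolynomial (Fin d) ℂ}
    {H K : HilbertModule.{u} (holAlgebra (quotientDomain θ))}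
    (hH : H.IsNormal G θ ℓ) (hK : K.IsNormal G θ ℓ) :
    (HilbertModule.directSum H K).IsNormal G θ ℓ := by
  intro x
  refine @WeakBilin.continuous_of_continuous_eval _ ℂ _ _ _ _ _ _ _ _ _ (weakStarTopology G θ ℓ) _ fun φ => ?_
  let x' : WithLp 2 (H × K) := x
  let φ' : StrongDual ℂ (WithLp 2 (H × K)) := φ
  let e : (H × K) →L[ℂ] WithLp 2 (H × K) :=
    (WithLp.prodContinuousLinearEquiv 2 ℂ H K).symm.toContinuousLinearMap
  have h1 := WeakBilin.eval_continuous (topDualPairing ℂ H).flip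
    (φ'.comp (e.comp (ContinuousLinearMap.inl ℂ H K)))
  have h2 := WeakBilin.eval_continuous (topDualPairing ℂ K).flip
    (φ'.comp (e.comp (ContinuousLinearMap.inr ℂ H K)))
  have h3 := @Continuous.comp _ _ _ (weakStarTopology G θ ℓ) _ _ _ _ h1 (hH x'.ofLp.1)
  have h4 := @Continuous.comp _ _ _ (weakStarTopology G θ ℓ) _ _ _ _ h2 (hK x'.ofLp.2)
  convert @Continuous.add _ _ _ _ _ (weakStarTopology G θ ℓ) _ _ h3 h4 using 1
  ext f
  change φ' (f • x') = φ' (e (f • x'.ofLp.1, 0)) + φ' (e (0, f • x'.ofLp.2))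
  rw [← map_add, ← map_add]
  congr 1
  apply WithLp.ofLp_injective
  change f • x'.ofLp = (f • x'.ofLp.1, (0 : K)) + ((0 : H), f • x'.ofLp.2)
  simp [Prod.ext_iff]

/-! ### The normal category, its extension groups and its projective objects -/

/-- An object of the normal category: a normal Hilbert module over `𝒜(θ(𝔻^d))`. -/
structure NormalHilbertModule {d : ℕ} (G : Subgroup ((Fin d → ℂ) ≃ₗ[ℂ] (Fin d → ℂ)))
    (θ : Fin d → MvPolynomial (Fin d) ℂ) (ℓ : MvPolynomial (Fin d) ℂ)
    extends HilbertModule.{u} (holAlgebra (quotientDomain θ)) where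
  isNormal : toHilbertModule.IsNormal G θ ℓ

namespace NormalHilbertModule

variable {d : ℕ} {G : Subgroup ((Fin d → ℂ) ≃ₗ[ℂ] (Fin d → ℂ))}
    {θ : Fin d → MvPolynomial (Fin d) ℂ} {ℓ : MvPolynomial (Fin d) ℂ}

instance : CoeSort (NormalHilbertModule.{u} G θ ℓ) (Type u) := ⟨fun H => H.toHilbertModule⟩

/-- A short exact sequence `0 → H → J → K → 0` in the normal category. -/
structure Extension (K H : NormalHilbertModule.{u} G θ ℓ) where
  J : NormalHilbertModule.{u} G θ ℓ
  α : H →L[holAlgebra (quotientDomain θ)] J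
  β : J →L[holAlgebra (quotientDomain θ)] K
  injective : Function.Injective α
  exact : Function.Exact α β
  surjective : Function.Surjective β

namespace Extension

variable {K H : NormalHilbertModule.{u} G θ ℓ}

/-- Equivalence of extensions: a module map `γ : J → J'` with `γ ∘ α = α'` and `β' ∘ γ = β`. -/
def Equivalent (E E' : Extension K H) : Prop :=
  ∃ γ : E.J →L[holAlgebra (quotientDomain θ)] E'.J, (∀ h : H, γ (E.α h) = E'.α h) ∧ ∀ j : E.J, E'.β (γ j) = E.β j

theorem Equivalent.symm {E E' : Extension K H} (h : Equivalent E E') : Equivalent E' E := by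
  obtain ⟨γ, h1, h2⟩ := h
  have hinj : Function.Injective γ := by
    rw [injective_iff_map_eq_zero]
    intro j hj
    have hb : E.β j = 0 := by rw [← h2, hj, map_zero]
    obtain ⟨x, rfl⟩ := (E.exact j).1 hb
    rw [h1] at hj
    rw [(injective_iff_map_eq_zero E'.α).1 E'.injective x hj, map_zero]
  have hsurj : Function.Surjective γ := by
    intro j'
    obtain ⟨j, hj⟩ := E.surjective (E'.β j')
    have : E'.β (j' - γ j) = 0 := by rw [map_sub, h2, hj, sub_self]
    obtain ⟨x, hx⟩ := (E'.exact _).1 this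
    exact ⟨j + E.α x, by rw [map_add, h1, hx]; abel⟩
  let γℂ : E.J →L[ℂ] E'.J := γ.restrictScalars ℂ
  let e := ContinuousLinearEquiv.ofBijective γℂ
    (LinearMap.ker_eq_bot.2 hinj) (LinearMap.range_eq_top.2 hsurj)
  have he : ∀ x, γ (e.symm x) = x := fun x => e.apply_symm_apply x
  have he' : ∀ x, e.symm (γ x) = x := fun x => e.symm_apply_apply x
  refine ⟨{ toFun := e.symm
            map_add' := fun x y => map_add e.symm x y
            map_smul' := fun a x => hinj (by simp [he])
            cont := e.symm.continuous }, fun x => ?_, fun j => ?_⟩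
  · change e.symm (E'.α x) = E.α x
    rw [← h1, he']
  · change E.β (e.symm j) = E'.β j
    rw [← h2, he]

instance setoid (K H : NormalHilbertModule.{u} G θ ℓ) : Setoid (Extension K H) where
  r := Equivalent
  iseqv :=
    { refl := fun E => ⟨ContinuousLinearMap.id _ E.J, fun _ => rfl, fun _ => rfl⟩
      symm := Equivalent.symm
      trans := by
        rintro E E' E'' ⟨γ, h1, h2⟩ ⟨δ, h3, h4⟩
        exact ⟨δ.comp γ, fun h => by simp [h1, h3], fun j => by simp [h2, h4]⟩ }

/-- The split extension `0 → H → H ⊕ K → K → 0`. -/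
def split (K H : NormalHilbertModule.{u} G θ ℓ) : Extension K H where
  J := ⟨HilbertModule.directSum H.toHilbertModule K.toHilbertModule, H.isNormal.directSum K.isNormal⟩
  α := HilbertModule.inl H.toHilbertModule K.toHilbertModule
  β := HilbertModule.snd H.toHilbertModule K.toHilbertModule
  injective x y h := congrArg (fun z : WithLp 2 (H × K) => z.ofLp.1) h
  exact x := by
    constructor
    · intro h
      exact ⟨(WithLp.ofLp (p := 2) (V := H × K) x).1,
        WithLp.ofLp_injective 2 (Prod.ext rfl (Eq.symm h))⟩
    · rintro ⟨h, rfl⟩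
      rfl
  surjective k := ⟨(WithLp.toLp 2 (0, k) : WithLp 2 (H × K)), rfl⟩

/-- The sequence `0 → H → J → K → 0` splits: `β` has a right inverse that is a module map. -/
def Splits (E : Extension K H) : Prop := ∃ s : K →L[holAlgebra (quotientDomain θ)] E.J, ∀ k : K, E.β (s k) = k

end Extension

/-- `Ext(K, H)`: equivalence classes of extensions `0 → H → J → K → 0` in the normal category. -/
def Ext (K H : NormalHilbertModule.{u} G θ ℓ) := Quotient (Extension.setoid K H)

/-- The zero of `Ext(K, H)` is the class of the split extension. -/
instance (K H : NormalHilbertModule.{u} G θ ℓ) : Zero (Ext K H) := ⟨⟦Extension.split K H⟧⟩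

/-- `P` is projective in the normal category: every short exact sequence `0 → H → J → P → 0` of
normal Hilbert modules splits. -/
def IsProjective (P : NormalHilbertModule.{u} G θ ℓ) : Prop :=
  ∀ (H : NormalHilbertModule.{u} G θ ℓ) (E : Extension P H), E.Splits

end NormalHilbertModule

/-- A Hilbert module over `C(∂θ(𝔻^d))`, viewed as a Hilbert module over `𝒜(θ(𝔻^d))`. -/
def asQuotientModule {d : ℕ} (θ : Fin d → MvPolynomial (Fin d) ℂ)
    (N : HilbertModule.{u} C(quotientBoundary θ, ℂ)) :
    HilbertModule.{u} (holAlgebra (quotientDomain θ)) :=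
  N.restrictScalars (restrictToBoundary θ) (continuous_restrictToBoundary θ)

/-- A Hilbert module over `C(∂θ(𝔻^d))` that is normal over `𝒜(θ(𝔻^d))`, as an object of the normal
category. -/
def asNormalModule {d : ℕ} {G : Subgroup ((Fin d → ℂ) ≃ₗ[ℂ] (Fin d → ℂ))}
    {θ : Fin d → MvPolynomial (Fin d) ℂ} {ℓ : MvPolynomial (Fin d) ℂ}
    (N : HilbertModule.{u} C(quotientBoundary θ, ℂ)) (hN : (asQuotientModule θ N).IsNormal G θ ℓ) :
    NormalHilbertModule.{u} G θ ℓ :=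
  ⟨asQuotientModule θ N, hN⟩

end

/-! Call an element of `𝒜(θ(𝔻^d))` inner if it is unimodular on `θ(𝕋^d)`. The inner elements form a
commutative monoid `S`, and three facts about `S` give the theorem.

Boundedness: by the maximum principle on the polydisc, inner elements have norm at most one, so `S`
acts on every Hilbert module by uniformly bounded operators. The same principle puts the Šilov
boundary inside `θ(𝕋^d)`. Hence on a module over `C(∂θ(𝔻^d))` the elements of `S` are invertible,
with uniformly bounded inverses.

Generation (`innerMonoid_generates`): the closed algebra generated by `S` is all of `𝒜(θ(𝔻^d))`. If
`c` is a coordinate function, then some inner `u`, a power of `∏ zᵢ` upstairs, and some `w` in the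
algebra satisfy `w = u * conj c` on `θ(𝕋^d)`. For small `l` the quotient `(l c + u) / (1 + conj l
w)` is inner, and its first-order terms in `l` recover `c`. Polynomials in the coordinates are
dense: `f ∘ θ` is a uniform limit of polynomials on the closed polydisc, and averaging these over
`G` produces polynomials in `θ`.

Averaging: a surjection `β : J → N` has a bounded linear section `s₀`, by Hilbert space geometry. An
invariant mean over `s ∈ S` of the operators `s ∘ s₀ ∘ s⁻¹` is a section commuting with `S`, hence
with the whole algebra (`exists_moduleMap_section`). Dually, the mean of `s⁻¹ ∘ r₀ ∘ s` is a module
retraction onto an embedded copy of `N` (`exists_moduleMap_retraction`). These are the splittings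
required. -/

/-! ### Invariant means on commutative monoids -/

section InvariantMean

open scoped ENNReal InnerProductSpace ComplexConjugate

/-- If `w` is a combination of vectors `y - T s y`, some average of the operators `T s` makes it
small. -/
theorem exists_average_norm_lt {Y S : Type*} [NormedAddCommGroup Y] [NormedSpace ℂ Y]
    [CommMonoid S] (T : S →* (Y →L[ℂ] Y)) (hT : ∀ s y, ‖T s y‖ ≤ ‖y‖) (e : Y)
    (he : ∀ s, T s e = e) {w : Y}
    (hw : w ∈ Submodule.span ℂ {w | ∃ s y, w = y - T s y}) :
    ∀ ε > 0, ∃ E : Y →L[ℂ] Y, E e = e ∧ (∀ y, ‖E y‖ ≤ ‖y‖) ∧ (∀ s y, E (T s y) = T s (E y)) ∧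
      (∀ B : Y →L[ℂ] Y, (∀ s y, B (T s y) = T s (B y)) → ∀ y, E (B y) = B (E y)) ∧ ‖E w‖ < ε := by
  induction hw using Submodule.span_induction with
  | zero =>
    exact fun ε hε => ⟨ContinuousLinearMap.id ℂ Y, rfl, fun _ => le_rfl, fun _ _ => rfl,
      fun _ _ _ => rfl, by simpa using hε⟩
  | mem w hw =>
    obtain ⟨s, y, rfl⟩ := hw
    intro ε hε
    obtain ⟨n, hn⟩ := exists_nat_gt (2 * ‖y‖ / ε)
    have hn0 : (0 : ℝ) < n := lt_of_le_of_lt (by positivity) hn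
    have hnc : (n : ℂ) ≠ 0 := by
      intro h
      have : n = 0 := by exact_mod_cast h
      simp [this] at hn0
    -- The Cesàro average over powers of `s` telescopes on `y - T s y`, leaving a vector of norm at
    -- most `2‖y‖ / n`; this dictates the choice of `n`.
    let E : Y →L[ℂ] Y := (n : ℂ)⁻¹ • ∑ i ∈ Finset.range n, T (s ^ i)
    have hE : ∀ y, E y = (n : ℂ)⁻¹ • ∑ i ∈ Finset.range n, T (s ^ i) y := fun y => by
      simp [E]
    refine ⟨E, ?_, fun y => ?_, fun t y => ?_, fun B hB y => ?_, ?_⟩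
    · rw [hE]
      simp only [he, Finset.sum_const, Finset.card_range]
      rw [← Nat.cast_smul_eq_nsmul ℂ, smul_smul, inv_mul_cancel₀ hnc, one_smul]
    · rw [hE, norm_smul, norm_inv, Complex.norm_natCast, inv_mul_le_iff₀ hn0]
      refine (norm_sum_le _ _).trans ?_
      refine (Finset.sum_le_sum fun i _ => hT (s ^ i) y).trans ?_
      simp
    · simp only [hE, map_smul, map_sum]
      congr 1
      refine Finset.sum_congr rfl fun i _ => ?_
      rw [← mul_apply_eq_comp, ← mul_apply_eq_comp, ← map_mul, ← map_mul,
        mul_comm]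
    · simp only [hE, map_smul, map_sum, hB]
    · have h1 : E (y - T s y) = (n : ℂ)⁻¹ • (y - T (s ^ n) y) := by
        rw [hE]
        congr 1
        have h2 : ∀ i, T (s ^ i) (y - T s y) = T (s ^ i) y - T (s ^ (i + 1)) y := fun i => by
          rw [map_sub, pow_succ, map_mul T, mul_apply_eq_comp]
        simp only [h2]
        rw [Finset.sum_range_sub' (fun i => T (s ^ i) y)]
        simp
      rw [h1, norm_smul, norm_inv, Complex.norm_natCast, inv_mul_lt_iff₀ hn0]
      have h3 : ‖y - T (s ^ n) y‖ ≤ 2 * ‖y‖ :=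
        (norm_sub_le _ _).trans (by linarith [hT (s ^ n) y])
      rw [div_lt_iff₀ hε] at hn
      linarith
  | add x y _ _ hx hy =>
    intro ε hε
    obtain ⟨E, e1, e2, e3, e4, e5⟩ := hx (ε / 2) (half_pos hε)
    obtain ⟨F, f1, f2, f3, f4, f5⟩ := hy (ε / 2) (half_pos hε)
    -- Each average makes one summand small. They commute because each commutes with every operator
    -- that commutes with all `T s`; this is why that clause is carried through the induction.
    refine ⟨E.comp F, by simp [e1, f1], fun y => (e2 _).trans (f2 _), fun s y => by simp [e3, f3],
      fun B hB y => by simp [f4 B hB, e4 B hB], ?_⟩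
    have h1 : E (F (x + y)) = F (E x) + E (F y) := by rw [map_add, map_add, e4 F f3]
    change ‖E (F (x + y))‖ < ε
    rw [h1]
    calc ‖F (E x) + E (F y)‖ ≤ ‖F (E x)‖ + ‖E (F y)‖ := norm_add_le _ _
      _ ≤ ‖E x‖ + ‖F y‖ := add_le_add (f2 _) (e2 _)
      _ < ε := by linarith
  | smul c x _ hx =>
    intro ε hε
    obtain ⟨E, e1, e2, e3, e4, e5⟩ := hx (ε / (‖c‖ + 1)) (by positivity)
    refine ⟨E, e1, e2, e3, e4, ?_⟩
    rw [map_smul, norm_smul]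
    rw [lt_div_iff₀ (by positivity)] at e5
    nlinarith [norm_nonneg (E x), norm_nonneg c]

/-- Commuting contractions that fix a nonzero vector `e` have an invariant bounded functional that
does not vanish at `e`. -/
theorem exists_invariant_functional {Y S : Type*} [NormedAddCommGroup Y] [NormedSpace ℂ Y]
    [CommMonoid S] (T : S →* (Y →L[ℂ] Y)) (hT : ∀ s y, ‖T s y‖ ≤ ‖y‖) (e : Y) (he0 : e ≠ 0)
    (he : ∀ s, T s e = e) : ∃ m : Y →L[ℂ] ℂ, m e = 1 ∧ ∀ s y, m (T s y) = m y := by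
  -- A functional vanishing on `W` is invariant, so it suffices that `e ∉ W`. If `w` in the span
  -- were close to `e`, an average fixing `e` and almost killing `w` would make `‖e‖` too small.
  let W : Submodule ℂ Y := (Submodule.span ℂ {w | ∃ s y, w = y - T s y}).topologicalClosure
  have heW : e ∉ W := by
    intro hmem
    have hpos : 0 < ‖e‖ / 2 := half_pos (norm_pos_iff.2 he0)
    obtain ⟨w, hw, hdist⟩ := Metric.mem_closure_iff.1 hmem _ hpos
    obtain ⟨E, e1, e2, -, -, e5⟩ := exists_average_norm_lt T hT e he hw _ hpos
    rw [dist_eq_norm] at hdist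
    have h1 : ‖e - E w‖ ≤ ‖e - w‖ := by
      have := e2 (e - w)
      rwa [map_sub, e1] at this
    have h2 : ‖e‖ ≤ ‖e - E w‖ + ‖E w‖ := by
      simpa using norm_add_le (e - E w) (E w)
    linarith
  have : IsClosed (W : Set Y) := Submodule.isClosed_topologicalClosure _
  have hne : W.mkQ e ≠ 0 := by simpa using heW
  obtain ⟨f, hf⟩ := SeparatingDual.exists_eq_one (R := ℂ) hne
  refine ⟨f.comp W.mkQL, hf, fun s y => ?_⟩
  have h1 : y - T s y ∈ W :=
    Submodule.le_topologicalClosure _ (Submodule.subset_span ⟨s, y, rfl⟩)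
  have h2 : W.mkQ y = W.mkQ (T s y) := by
    simpa using (Submodule.Quotient.eq W).2 h1
  change f (W.mkQ (T s y)) = f (W.mkQ y)
  rw [h2]

/-- The bounded complex functions on `S`. -/
noncomputable abbrev BoundedFn (S : Type*) := lp (fun _ : S => ℂ) ∞

/-- A bounded function as an element of `ℓ^∞`. -/
noncomputable def BoundedFn.mk {S : Type*} (f : S → ℂ) (C : ℝ) (hf : ∀ s, ‖f s‖ ≤ C) : BoundedFn S :=
  ⟨f, memℓp_infty ⟨C, by rintro _ ⟨s, rfl⟩; exact hf s⟩⟩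

theorem BoundedFn.norm_mk_le {S : Type*} [Nonempty S] (f : S → ℂ) (C : ℝ)
    (hf : ∀ s, ‖f s‖ ≤ C) : ‖BoundedFn.mk f C hf‖ ≤ C :=
  lp.norm_le_of_forall_le ((norm_nonneg _).trans (hf (Classical.arbitrary S))) hf

/-- An invariant mean on a monoid. -/
structure InvariantMean (S : Type*) [CommMonoid S] where
  toCLM : BoundedFn S →L[ℂ] ℂ
  const : ∀ (c : ℂ) (f : BoundedFn S), (∀ s, f s = c) → toCLM f = c
  invariant : ∀ (a : S) (f g : BoundedFn S), (∀ s, g s = f (a * s)) → toCLM g = toCLM f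

/-- Translations of `ℓ^∞(S)` are commuting contractions fixing the constant function one. Positivity
of the mean is never needed: boundedness is enough, at the cost of a factor `‖m.toCLM‖` in the
estimates below. -/
theorem nonempty_invariantMean (S : Type*) [CommMonoid S] : Nonempty (InvariantMean S) := by
  have hbd : ∀ (f : BoundedFn S) s, ‖f s‖ ≤ ‖f‖ := fun f s => lp.norm_apply_le_norm (by simp) f s
  let τ : S → BoundedFn S →L[ℂ] BoundedFn S := fun a =>
    LinearMap.mkContinuous
      { toFun := fun f => BoundedFn.mk (fun s => f (a * s)) ‖f‖ fun s => hbd f _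
        map_add' := fun f g => by ext s; rfl
        map_smul' := fun c f => by ext s; rfl } 1 fun f => by
        rw [one_mul]
        exact BoundedFn.norm_mk_le _ _ fun s => hbd f _
  have hτ : ∀ a f s, τ a f s = f (a * s) := fun a f s => rfl
  let T : S →* (BoundedFn S →L[ℂ] BoundedFn S) :=
    { toFun := τ
      map_one' := by
        ext f s
        rw [hτ, one_mul]
        rfl
      map_mul' := fun a b => by
        ext f s
        rw [mul_apply_eq_comp, hτ, hτ, hτ, mul_comm a b, mul_assoc] }
  let e : BoundedFn S := BoundedFn.mk (fun _ => 1) 1 (by simp)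
  have he0 : e ≠ 0 := fun h => by
    have h1 : e 1 = (0 : BoundedFn S) 1 := by rw [h]
    have h2 : (1 : ℂ) = 0 := h1
    exact one_ne_zero h2
  obtain ⟨m, m1, m2⟩ := exists_invariant_functional T
    (fun a f => BoundedFn.norm_mk_le _ _ fun s => hbd f _) e he0 (fun a => by ext s; rfl)
  refine ⟨m, fun c f hf => ?_, fun a f g h => ?_⟩
  · have : f = c • e := by
      ext s
      rw [hf]
      change c = c * 1
      rw [mul_one]
    rw [this, map_smul, m1, smul_eq_mul, mul_one]
  · rw [← m2 a f]
    congr 1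
    ext s
    exact h s

namespace InvariantMean

theorem inner_bound {S H : Type*} [NormedAddCommGroup H] [InnerProductSpace ℂ H]
    {v : S → H} {C : ℝ} (hv : ∀ s, ‖v s‖ ≤ C) (y : H) (s : S) :
    ‖⟪y, v s⟫_ℂ‖ ≤ C * ‖y‖ := by
  rw [mul_comm]
  exact (norm_inner_le_norm _ _).trans (mul_le_mul_of_nonneg_left (hv s) (norm_nonneg _))

theorem op_bound {S X H : Type*} [NormedAddCommGroup X] [NormedSpace ℂ X]
    [NormedAddCommGroup H] [NormedSpace ℂ H] {P : S → X →L[ℂ] H} {C : ℝ} (hP : ∀ s, ‖P s‖ ≤ C) (x : X) (s : S) :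
    ‖P s x‖ ≤ C * ‖x‖ :=
  (P s).le_of_opNorm_le (hP s) x

variable {S : Type*} [CommMonoid S] (m : InvariantMean S)
  {X H K : Type*} [NormedAddCommGroup X] [NormedSpace ℂ X]
  [NormedAddCommGroup H] [InnerProductSpace ℂ H] [CompleteSpace H]
  [NormedAddCommGroup K] [InnerProductSpace ℂ K] [CompleteSpace K]

/-- The weak mean of a bounded Hilbert space valued function. -/
noncomputable def vectorMean (v : S → H) (C : ℝ) (hv : ∀ s, ‖v s‖ ≤ C) : H :=
  (InnerProductSpace.toDual ℂ H).symm <| LinearMap.mkContinuous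
    -- The inner product is conjugate linear in its first variable; the conjugate restores the
    -- linearity needed for the Riesz representation.
    { toFun := fun y => conj (m.toCLM (BoundedFn.mk _ _ (inner_bound hv y)))
      map_add' := fun y z => by
        rw [← map_add, ← map_add]
        congr 2
        ext s
        exact inner_add_left _ _ _
      map_smul' := fun c y => by
        have h : BoundedFn.mk _ _ (inner_bound hv (c • y)) =
            conj c • BoundedFn.mk _ _ (inner_bound hv y) := by
          ext s
          exact inner_smul_left _ _ _
        rw [h, map_smul, smul_eq_mul, map_mul, RingHomCompTriple.comp_apply]
        rfl } (‖m.toCLM‖ * C) fun y => by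
      change ‖conj _‖ ≤ _
      rw [RCLike.norm_conj, mul_assoc]
      exact (m.toCLM.le_opNorm _).trans
        (mul_le_mul_of_nonneg_left (BoundedFn.norm_mk_le _ _ _) (norm_nonneg _))

theorem inner_vectorMean (v : S → H) (C : ℝ) (hv : ∀ s, ‖v s‖ ≤ C) (y : H) :
    ⟪y, m.vectorMean v C hv⟫_ℂ = m.toCLM (BoundedFn.mk _ _ (inner_bound hv y)) := by
  rw [← inner_conj_symm, vectorMean, InnerProductSpace.toDual_symm_apply]
  exact Complex.conj_conj _

theorem norm_vectorMean_le (v : S → H) (C : ℝ) (hv : ∀ s, ‖v s‖ ≤ C) :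
    ‖m.vectorMean v C hv‖ ≤ ‖m.toCLM‖ * C := by
  rw [vectorMean, LinearIsometryEquiv.norm_map]
  exact LinearMap.mkContinuous_norm_le _
    (mul_nonneg (norm_nonneg _) ((norm_nonneg _).trans (hv 1))) _

/-- The weak mean of a bounded family of operators. -/
noncomputable def opMean (P : S → X →L[ℂ] H) (C : ℝ) (hP : ∀ s, ‖P s‖ ≤ C) : X →L[ℂ] H :=
  LinearMap.mkContinuous
    { toFun := fun x => m.vectorMean (fun s => P s x) (C * ‖x‖) (op_bound hP x)
      map_add' := fun x x' => by
        refine ext_inner_left ℂ fun y => ?_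
        rw [inner_add_right, inner_vectorMean, inner_vectorMean, inner_vectorMean, ← map_add]
        congr 1
        ext s
        change ⟪y, P s (x + x')⟫_ℂ = ⟪y, P s x⟫_ℂ + ⟪y, P s x'⟫_ℂ
        rw [map_add, inner_add_right]
      map_smul' := fun c x => by
        refine ext_inner_left ℂ fun y => ?_
        rw [inner_smul_right, inner_vectorMean, inner_vectorMean, RingHom.id_apply]
        refine Eq.trans (congrArg m.toCLM ?_) (map_smul m.toCLM c _)
        ext s
        change ⟪y, P s (c • x)⟫_ℂ = c * ⟪y, P s x⟫_ℂ
        rw [map_smul, inner_smul_right] } (‖m.toCLM‖ * C) fun x => by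
      rw [mul_assoc]
      exact m.norm_vectorMean_le _ _ (op_bound hP x)

theorem inner_opMean (P : S → X →L[ℂ] H) (C : ℝ) (hP : ∀ s, ‖P s‖ ≤ C) (x : X) (y : H) :
    ⟪y, m.opMean P C hP x⟫_ℂ =
      m.toCLM (BoundedFn.mk _ _ (inner_bound (op_bound hP x) y)) :=
  m.inner_vectorMean _ _ (op_bound hP x) _

/-- If `B (P s x) = z` for all `s`, then the mean has the same property. -/
theorem map_opMean_eq (P : S → X →L[ℂ] H) (C : ℝ) (hP : ∀ s, ‖P s‖ ≤ C) (B : H →L[ℂ] K) (x : X)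
    (z : K) (h : ∀ s, B (P s x) = z) : B (m.opMean P C hP x) = z := by
  refine ext_inner_left ℂ fun y => ?_
  rw [← ContinuousLinearMap.adjoint_inner_left, inner_opMean]
  refine m.const _ _ fun s => ?_
  change ⟪B.adjoint y, P s x⟫_ℂ = _
  rw [ContinuousLinearMap.adjoint_inner_left, h]

/-- If `B (P s x) = P (a * s) x'` for all `s`, then `B` sends the mean at `x` to that at `x'`. -/
theorem map_opMean_eq_of_translate (P : S → X →L[ℂ] H) (C : ℝ) (hP : ∀ s, ‖P s‖ ≤ C)
    (B : H →L[ℂ] H) (a : S) (x x' : X) (h : ∀ s, B (P s x) = P (a * s) x') :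
    B (m.opMean P C hP x) = m.opMean P C hP x' := by
  refine ext_inner_left ℂ fun y => ?_
  rw [← ContinuousLinearMap.adjoint_inner_left, inner_opMean, inner_opMean]
  refine m.invariant a _ _ fun s => ?_
  change ⟪B.adjoint y, P s x⟫_ℂ = ⟪y, P (a * s) x'⟫_ℂ
  rw [ContinuousLinearMap.adjoint_inner_left, h]

end InvariantMean

end InvariantMean

/-! ### Averaging sections and retractions -/

section HilbertSplitting

variable {H K : Type*} [NormedAddCommGroup H] [InnerProductSpace ℂ H] [CompleteSpace H]
  [NormedAddCommGroup K] [InnerProductSpace ℂ K] [CompleteSpace K]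

/-- The restriction of `β` to the orthogonal complement of its kernel is bijective, so the open
mapping theorem inverts it. -/
theorem exists_rightInverse_of_surjective (β : H →L[ℂ] K) (hβ : Function.Surjective β) :
    ∃ s : K →L[ℂ] H, ∀ k, β (s k) = k := by
  let M : Submodule ℂ H := LinearMap.ker β.toLinearMap
  have hM : IsClosed (M : Set H) := β.isClosed_ker
  have : CompleteSpace M := hM.completeSpace_coe
  let β' : Mᗮ →L[ℂ] K := β.comp Mᗮ.subtypeL
  have hinj : LinearMap.ker β'.toLinearMap = ⊥ := by
    rw [LinearMap.ker_eq_bot']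
    intro x hx
    have h1 : (x : H) ∈ M := hx
    have h2 : (x : H) ∈ M ⊓ Mᗮ := ⟨h1, x.2⟩
    rw [M.inf_orthogonal_eq_bot] at h2
    exact Subtype.ext ((Submodule.mem_bot ℂ).1 h2)
  have hsurj : LinearMap.range β'.toLinearMap = ⊤ := by
    rw [LinearMap.range_eq_top]
    intro k
    obtain ⟨x, hx⟩ := hβ k
    obtain ⟨y, hy, z, hz, rfl⟩ := M.exists_add_mem_mem_orthogonal x
    refine ⟨⟨z, hz⟩, ?_⟩
    have h1 : β y = 0 := hy
    rw [map_add, h1, zero_add] at hx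
    exact hx
  let e := ContinuousLinearEquiv.ofBijective β' hinj hsurj
  exact ⟨Mᗮ.subtypeL.comp e.symm.toContinuousLinearMap, fun k => e.apply_symm_apply k⟩

/-- Project orthogonally onto the closed range, then invert `α` there. -/
theorem exists_leftInverse_of_injective (α : K →L[ℂ] H) (hα : Function.Injective α)
    (hr : IsClosed (Set.range α)) : ∃ r : H →L[ℂ] K, ∀ k, r (α k) = k := by
  let M : Submodule ℂ H := LinearMap.range α.toLinearMap
  have hM : IsClosed (M : Set H) := hr
  have : CompleteSpace M := hM.completeSpace_coe
  let e := α.equivRange hα hr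
  refine ⟨e.symm.toContinuousLinearMap.comp M.orthogonalProjectionOnto, fun k => ?_⟩
  have h1 : M.orthogonalProjectionOnto (α k) = e k :=
    M.orthogonalProjectionOnto_mem_subspace_eq_self (e k)
  change e.symm (M.orthogonalProjectionOnto (α k)) = k
  rw [h1, e.symm_apply_apply]

end HilbertSplitting

namespace HilbertModule

variable {A : Type v} [CommRing A] [Algebra ℂ A] [TopologicalSpace A]

instance (H : HilbertModule.{u} A) : SMulCommClass ℂ A H := IsScalarTower.to_smulCommClass

/-- The action of an algebra element as a bounded operator. -/
noncomputable def actCLM (H : HilbertModule.{u} A) (a : A) : H →L[ℂ] H where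
  toFun x := a • x
  map_add' := smul_add a
  map_smul' c x := smul_comm a c x
  cont := continuous_const_smul a

@[simp]
theorem actCLM_apply (H : HilbertModule.{u} A) (a : A) (x : H) : H.actCLM a x = a • x := rfl

/-- The submonoid `S` of `A` acts boundedly on `H`. -/
def ActsBoundedly (S : Submonoid A) (H : HilbertModule.{u} A) : Prop :=
  ∃ C : ℝ, ∀ s : S, ‖H.actCLM (s : A)‖ ≤ C

/-- The submonoid `S` of `A` acts on `H` by invertible operators with bounded inverses. -/
def ActsBoundedlyInvertibly (S : Submonoid A) (H : HilbertModule.{u} A) : Prop :=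
  ∃ (C : ℝ) (R : S → H →L[ℂ] H), (∀ s, ‖R s‖ ≤ C) ∧
    (∀ (s : S) x, R s ((s : A) • x) = x) ∧ ∀ (s : S) x, (s : A) • R s x = x

/-- `S` generates `A` as a closed subalgebra. -/
def TopologicallyGenerates (S : Submonoid A) : Prop :=
  ∀ B : Subalgebra ℂ A, IsClosed (B : Set A) → (S : Set A) ⊆ B → B = ⊤

/-- A bounded operator that commutes with the action of `S` is a module map. -/
theorem map_smul_of_generates {S : Submonoid A} (hS : TopologicallyGenerates S)
    {H K : HilbertModule.{u} A} (T : H →L[ℂ] K) (hT : ∀ (s : S) x, T ((s : A) • x) = (s : A) • T x)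
    (a : A) (x : H) : T (a • x) = a • T x := by
  -- The elements whose action commutes with `T` form a closed subalgebra containing `S`.
  let B : Subalgebra ℂ A :=
    { carrier := {a | ∀ x, T (a • x) = a • T x}
      mul_mem' := fun {a b} ha hb x => by rw [mul_smul, ha, hb, mul_smul]
      add_mem' := fun {a b} ha hb x => by rw [add_smul, map_add, ha, hb, add_smul]
      algebraMap_mem' := fun c x => by rw [algebraMap_smul, map_smul, algebraMap_smul] }
  have hB : IsClosed (B : Set A) := by
    have : (B : Set A) = ⋂ x, {a | T (a • x) = a • T x} := by
      ext a
      simp only [Set.mem_iInter]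
      rfl
    rw [this]
    exact isClosed_iInter fun x => isClosed_eq (by fun_prop) (by fun_prop)
  have h1 := hS B hB fun s hs => hT ⟨s, hs⟩
  have h2 : a ∈ B := h1 ▸ Algebra.mem_top
  exact h2 x

/-- A bounded operator that commutes with the action of `S`, as a module map. -/
noncomputable def moduleMap {S : Submonoid A} (hS : TopologicallyGenerates S)
    {H K : HilbertModule.{u} A} (T : H →L[ℂ] K)
    (hT : ∀ (s : S) x, T ((s : A) • x) = (s : A) • T x) : H →L[A] K where
  toFun := T
  map_add' := map_add T
  map_smul' := map_smul_of_generates hS T hT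
  cont := T.continuous

/-- This is `(a s)⁻¹ a = s⁻¹`, the identity that turns equivariance of the averaged families into
translation invariance of the mean. -/
theorem ActsBoundedlyInvertibly.inverse_mul_apply {S : Submonoid A} {H : HilbertModule.{u} A}
    {R : S → H →L[ℂ] H} (h1 : ∀ (s : S) x, R s ((s : A) • x) = x)
    (h2 : ∀ (s : S) x, (s : A) • R s x = x) (a s : S) (x : H) :
    R (a * s) ((a : A) • x) = R s x := by
  have h : (a : A) • x = ((a * s : S) : A) • R s x := by
    rw [Submonoid.coe_mul, mul_smul, h2]
  rw [h, h1]

/-- A surjective module map onto a module on which `S` acts by invertible operators has a section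
that is a module map. -/
theorem exists_moduleMap_section {S : Submonoid A} (hS : TopologicallyGenerates S)
    {J N : HilbertModule.{u} A} (hJ : ActsBoundedly S J) (hN : ActsBoundedlyInvertibly S N)
    (β : J →L[A] N) (hβ : Function.Surjective β) : ∃ s : N →L[A] J, ∀ x, β (s x) = x := by
  obtain ⟨m⟩ := nonempty_invariantMean S
  obtain ⟨C, hC⟩ := hJ
  obtain ⟨C', R, hR, h1, h2⟩ := hN
  let βc : J →L[ℂ] N := β.restrictScalars ℂ
  have hβc : ∀ x, βc x = β x := fun _ => rfl
  obtain ⟨s₀, hs₀⟩ := exists_rightInverse_of_surjective βc hβ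
  -- The conjugates `s ∘ s₀ ∘ s⁻¹`. Each is again a section since `β` is a module map, and `a • P s
  -- x = P (a * s) (a • x)`, so their mean commutes with `S`.
  let P : S → N →L[ℂ] J := fun s => (J.actCLM (s : A)).comp (s₀.comp (R s))
  have hPa : ∀ s x, P s x = (s : A) • s₀ (R s x) := fun _ _ => rfl
  have hC0 : 0 ≤ C := (norm_nonneg _).trans (hC 1)
  have hP : ∀ s, ‖P s‖ ≤ C * (‖s₀‖ * C') := fun s => by
    refine (ContinuousLinearMap.opNorm_comp_le _ _).trans (mul_le_mul (hC s) ?_ (norm_nonneg _) hC0)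
    exact (ContinuousLinearMap.opNorm_comp_le _ _).trans
      (mul_le_mul_of_nonneg_left (hR s) (norm_nonneg _))
  refine ⟨moduleMap hS (m.opMean P _ hP) fun a x => ?_, fun x => ?_⟩
  · refine (m.map_opMean_eq_of_translate P _ hP (J.actCLM (a : A)) a x ((a : A) • x) fun s => ?_).symm
    rw [hPa, hPa, ActsBoundedlyInvertibly.inverse_mul_apply h1 h2, actCLM_apply, smul_smul,
      Submonoid.coe_mul]
  · refine m.map_opMean_eq P _ hP βc x x fun s => ?_
    rw [hPa, hβc, map_smul, ← hβc, hs₀, h2]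

/-- An injective module map with closed range from a module on which `S` acts by invertible
operators has a retraction that is a module map. -/
theorem exists_moduleMap_retraction {S : Submonoid A} (hS : TopologicallyGenerates S)
    {J N : HilbertModule.{u} A} (hJ : ActsBoundedly S J) (hN : ActsBoundedlyInvertibly S N)
    (α : N →L[A] J) (hα : Function.Injective α) (hr : IsClosed (Set.range α)) :
    ∃ r : J →L[A] N, ∀ x, r (α x) = x := by
  obtain ⟨m⟩ := nonempty_invariantMean S
  obtain ⟨C, hC⟩ := hJ
  obtain ⟨C', R, hR, h1, h2⟩ := hN
  let αc : N →L[ℂ] J := α.restrictScalars ℂ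
  have hαc : ∀ x, αc x = α x := fun _ => rfl
  obtain ⟨r₀, hr₀⟩ := exists_leftInverse_of_injective αc hα hr
  -- The conjugates `s⁻¹ ∘ r₀ ∘ s`, each again a left inverse of `α`. Here `R a (P s (a • x)) = P (a
  -- * s) x`, which yields `hinv` for the mean.
  let P : S → J →L[ℂ] N := fun s => (R s).comp (r₀.comp (J.actCLM (s : A)))
  have hPa : ∀ s x, P s x = R s (r₀ ((s : A) • x)) := fun _ _ => rfl
  have hC0 : 0 ≤ C' := (norm_nonneg _).trans (hR 1)
  have hP : ∀ s, ‖P s‖ ≤ C' * (‖r₀‖ * C) := fun s => by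
    refine (ContinuousLinearMap.opNorm_comp_le _ _).trans (mul_le_mul (hR s) ?_ (norm_nonneg _) hC0)
    exact (ContinuousLinearMap.opNorm_comp_le _ _).trans
      (mul_le_mul_of_nonneg_left (hC s) (norm_nonneg _))
  have hinv : ∀ (a : S) x, R a (m.opMean P _ hP ((a : A) • x)) = m.opMean P _ hP x := fun a x => by
    refine m.map_opMean_eq_of_translate P _ hP (R a) a _ _ fun s => ?_
    have h3 : R s (r₀ ((s : A) • (a : A) • x)) =
        (a : A) • R (a * s) (r₀ (((a * s : S) : A) • x)) := by
      rw [← ActsBoundedlyInvertibly.inverse_mul_apply h1 h2 a s, smul_smul, mul_comm (s : A),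
        ← Submonoid.coe_mul]
      have h4 : ∀ y, R (a * s) ((a : A) • y) = (a : A) • R (a * s) y := fun y => by
        conv_lhs => rw [← h2 (a * s) y, smul_comm, h1]
      rw [h4]
    rw [hPa, hPa, h3, h1]
  refine ⟨moduleMap hS (m.opMean P _ hP) fun a x => ?_, fun x => ?_⟩
  · rw [← hinv a x, h2]
  · refine m.map_opMean_eq P _ hP (ContinuousLinearMap.id ℂ N) (αc x) x fun s => ?_
    rw [hPa, hαc, ← map_smul, ← hαc, hr₀]
    exact h1 s x

end HilbertModule

/-! ### Polynomial approximation and the maximum principle on the polydisc -/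

section Polydisc

open Metric Filter

variable {d : ℕ}

/-- The coordinate functions on the closed polydisc. -/
def polydiscCoord (i : Fin d) : C(closedBall (0 : Fin d → ℂ) 1, ℂ) where
  toFun z := z.1 i
  continuous_toFun := (continuous_apply i).comp continuous_subtype_val

/-- The uniform closure of the polynomials on the closed polydisc. -/
noncomputable def polydiscAlgebra (d : ℕ) : Subalgebra ℂ C(closedBall (0 : Fin d → ℂ) 1, ℂ) :=
  (MvPolynomial.aeval (R := ℂ) polydiscCoord).range.topologicalClosure

theorem isClosed_polydiscAlgebra :
    IsClosed (polydiscAlgebra d : Set C(closedBall (0 : Fin d → ℂ) 1, ℂ)) :=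
  Subalgebra.isClosed_topologicalClosure _

theorem aeval_polydiscCoord_apply (q : MvPolynomial (Fin d) ℂ) (z : closedBall (0 : Fin d → ℂ) 1) :
    MvPolynomial.aeval polydiscCoord q z = MvPolynomial.eval z.1 q := by
  induction q using MvPolynomial.induction_on with
  | C a => simp
  | add p q hp hq => simp [hp, hq]
  | mul_X p i hp =>
    rw [map_mul, ContinuousMap.mul_apply, hp, map_mul, MvPolynomial.aeval_X, MvPolynomial.eval_X]
    rfl

theorem aeval_mem_polydiscAlgebra (q : MvPolynomial (Fin d) ℂ) :
    MvPolynomial.aeval polydiscCoord q ∈ polydiscAlgebra d :=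
  Subalgebra.le_topologicalClosure _ ⟨q, rfl⟩

/-- Elements of the polydisc algebra are uniform limits of polynomials. -/
theorem exists_polynomial_near {f : C(closedBall (0 : Fin d → ℂ) 1, ℂ)}
    (hf : f ∈ polydiscAlgebra d) {ε : ℝ} (hε : 0 < ε) :
    ∃ q : MvPolynomial (Fin d) ℂ, ∀ z : closedBall (0 : Fin d → ℂ) 1,
      ‖f z - MvPolynomial.eval z.1 q‖ ≤ ε := by
  obtain ⟨_, ⟨q, rfl⟩, hq⟩ := Metric.mem_closure_iff.1 hf ε hε
  refine ⟨q, fun z => ?_⟩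
  rw [← aeval_polydiscCoord_apply, ← dist_eq_norm]
  exact (ContinuousMap.dist_apply_le_dist z).trans hq.le

theorem norm_polydiscCoord_le (i : Fin d) : ‖polydiscCoord i‖ ≤ 1 := by
  rw [ContinuousMap.norm_le _ zero_le_one]
  exact fun z => (norm_le_pi_norm z.1 i).trans (mem_closedBall_zero_iff.1 z.2)

/-- The Cauchy kernel in one coordinate belongs to the polydisc algebra. -/
theorem cauchyKernel_mem_polydiscAlgebra (j : Fin d) {w : ℂ} (hw : 1 < ‖w‖)
    {k : C(closedBall (0 : Fin d → ℂ) 1, ℂ)} (hk : ∀ z, k z = (w - z.1 j)⁻¹) :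
    k ∈ polydiscAlgebra d := by
  have hw0 : w ≠ 0 := norm_pos_iff.1 (zero_lt_one.trans hw)
  -- The kernel is the geometric series `w⁻¹ ∑ (z j / w)ⁿ`, uniformly convergent because `|w| > 1`.
  let x : C(closedBall (0 : Fin d → ℂ) 1, ℂ) := w⁻¹ • polydiscCoord j
  have hx : ‖x‖ < 1 := by
    rw [norm_smul, norm_inv]
    calc ‖w‖⁻¹ * ‖polydiscCoord j‖ ≤ ‖w‖⁻¹ * 1 :=
          mul_le_mul_of_nonneg_left (norm_polydiscCoord_le j) (by positivity)
      _ < 1 := by rw [mul_one]; exact inv_lt_one_of_one_lt₀ hw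
  have hxV : x ∈ polydiscAlgebra d := by
    refine (polydiscAlgebra d).smul_mem ?_ _
    have := aeval_mem_polydiscAlgebra (MvPolynomial.X j)
    rwa [MvPolynomial.aeval_X] at this
  have hsum : (∑' n : ℕ, x ^ n) ∈ polydiscAlgebra d :=
    isClosed_polydiscAlgebra.mem_of_tendsto
      (summable_geometric_of_norm_lt_one hx).hasSum
      (Eventually.of_forall fun s => sum_mem fun n _ => pow_mem hxV n)
  have hkx : k = w⁻¹ • ∑' n : ℕ, x ^ n := by
    have h1 : (1 - x) * ∑' n : ℕ, x ^ n = 1 := mul_neg_geom_series x hx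
    ext z
    have h2 : (1 - w⁻¹ * z.1 j) * (∑' n : ℕ, x ^ n) z = 1 := congrArg (fun f => f z) h1
    rw [hk, ContinuousMap.smul_apply, smul_eq_mul, eq_comm]
    refine eq_inv_of_mul_eq_one_left ?_
    rw [← h2]
    field_simp
  rw [hkx]
  exact (polydiscAlgebra d).smul_mem hsum _

theorem update_mem_closedBall {v : Fin d → ℂ} {r : ℝ} (hv : v ∈ closedBall 0 r) (j : Fin d)
    {ζ : ℂ} (hζ : ‖ζ‖ ≤ r) : Function.update v j ζ ∈ closedBall 0 r := by
  have hr : 0 ≤ r := (norm_nonneg _).trans hζ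
  rw [mem_closedBall_zero_iff, pi_norm_le_iff_of_nonneg hr] at hv ⊢
  intro i
  by_cases h : i = j
  · subst h
    simpa using hζ
  · simpa [h] using hv i

theorem differentiable_update (v : Fin d → ℂ) (j : Fin d) :
    Differentiable ℂ fun ζ : ℂ => Function.update v j ζ := by
  rw [differentiable_pi]
  intro i
  by_cases h : i = j
  · subst h
    simp
  · simp [h]

/-- Induction on the set `s` of active variables, the others being frozen at `w`. Cauchy's formula
for a new variable `j` on the circle of radius `r` writes `f` as an integral of the kernel times
functions with `j` frozen on that circle, which the induction hypothesis covers because `w` ranges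
over the ball of radius `r`. -/
theorem partial_mem_polydiscAlgebra {F : (Fin d → ℂ) → ℂ} {r : ℝ} (hr : 1 < r)
    (hF : ∀ z ∈ closedBall 0 r, DifferentiableAt ℂ F z) (s : Finset (Fin d)) :
    ∀ w ∈ closedBall (0 : Fin d → ℂ) r, ∀ f : C(closedBall (0 : Fin d → ℂ) 1, ℂ),
      (∀ z, f z = F (s.piecewise z.1 w)) → f ∈ polydiscAlgebra d := by
  have hr0 : 0 < r := zero_lt_one.trans hr
  induction s using Finset.induction_on with
  | empty =>
    intro w _ f hf
    have : f = algebraMap ℂ _ (F w) := by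
      ext z
      rw [hf, Finset.piecewise_empty]
      rfl
    rw [this]
    exact Subalgebra.algebraMap_mem _ _
  | insert j s hj ih =>
    intro w hw f hf
    let V := Subalgebra.toSubmodule (polydiscAlgebra d)
    have hVc : IsClosed (V : Set C(closedBall (0 : Fin d → ℂ) 1, ℂ)) := isClosed_polydiscAlgebra
    have : CompleteSpace V := hVc.completeSpace_coe
    have hpw : ∀ z : closedBall (0 : Fin d → ℂ) 1, s.piecewise z.1 w ∈ closedBall 0 r := by
      intro z
      have hz := z.2
      rw [mem_closedBall_zero_iff, pi_norm_le_iff_of_nonneg hr0.le] at hw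
      rw [mem_closedBall_zero_iff, pi_norm_le_iff_of_nonneg zero_le_one] at hz
      rw [mem_closedBall_zero_iff, pi_norm_le_iff_of_nonneg hr0.le]
      intro i
      by_cases h : i ∈ s
      · simpa [h] using (hz i).trans hr.le
      · simpa [h] using hw i
    have hcm : ∀ t, ‖circleMap 0 r t‖ = r := fun t => by simp [abs_of_pos hr0]
    have hne : ∀ (t : ℝ) (z : closedBall (0 : Fin d → ℂ) 1), circleMap 0 r t - z.1 j ≠ 0 := by
      intro t z h
      have h1 : ‖z.1 j‖ ≤ 1 := (norm_le_pi_norm z.1 j).trans (mem_closedBall_zero_iff.1 z.2)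
      rw [← sub_eq_zero.1 h, hcm] at h1
      linarith
    let kern : C(ℝ × closedBall (0 : Fin d → ℂ) 1, ℂ) :=
      { toFun := fun p => (circleMap 0 r p.1 - p.2.1 j)⁻¹
        continuous_toFun := by
          refine Continuous.inv₀ ?_ fun p => hne p.1 p.2
          exact ((continuous_circleMap 0 r).comp continuous_fst).sub
            ((continuous_apply j).comp (continuous_subtype_val.comp continuous_snd)) }
    let val : C(ℝ × closedBall (0 : Fin d → ℂ) 1, ℂ) :=
      { toFun := fun p => F (Function.update (s.piecewise p.2.1 w) j (circleMap 0 r p.1))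
        continuous_toFun := by
          have hFc : ContinuousOn F (closedBall 0 r) := fun z hz =>
            (hF z hz).continuousAt.continuousWithinAt
          refine hFc.comp_continuous ?_ fun p => update_mem_closedBall (hpw p.2) j (hcm _).le
          refine Continuous.update ?_ j ((continuous_circleMap 0 r).comp continuous_fst)
          refine continuous_pi fun i => ?_
          by_cases h : i ∈ s
          · simp only [h, Finset.piecewise_eq_of_mem]
            exact (continuous_apply i).comp (continuous_subtype_val.comp continuous_snd)
          · simp only [h, not_false_eq_true, Finset.piecewise_eq_of_notMem]
            exact continuous_const }
    have hkern : ∀ t, kern.curry t ∈ V := fun t =>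
      cauchyKernel_mem_polydiscAlgebra j (w := circleMap 0 r t) (by rw [hcm]; exact hr)
        fun z => rfl
    have hval : ∀ t, val.curry t ∈ V := fun t => by
      refine ih (Function.update w j (circleMap 0 r t)) (update_mem_closedBall hw j (hcm t).le) _
        fun z => ?_
      rw [← Finset.update_piecewise_of_notMem s _ _ hj]
      rfl
    -- The integrand is a continuous curve in the complete subspace `V`, so its Bochner integral
    -- lies in `V`; evaluation at each `z` identifies the integral with `f`.
    let Φ : ℝ → V := fun t =>
      ⟨(2 * Real.pi * Complex.I : ℂ)⁻¹ • deriv (circleMap 0 r) t • (kern.curry t * val.curry t),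
        V.smul_mem _ (V.smul_mem _ ((polydiscAlgebra d).mul_mem (hkern t) (hval t)))⟩
    have hΦ : Continuous Φ := by
      refine Continuous.subtype_mk ?_ _
      have h1 : Continuous (deriv (circleMap 0 r)) := by
        rw [show deriv (circleMap 0 r) = fun t => circleMap 0 r t * Complex.I from
          funext fun t => deriv_circleMap 0 r t]
        exact (continuous_circleMap 0 r).mul continuous_const
      have h2 := h1.smul ((map_continuous kern.curry).mul (map_continuous val.curry))
      exact h2.const_smul (2 * Real.pi * Complex.I : ℂ)⁻¹
    have hfΦ : f = ((∫ t in (0 : ℝ)..2 * Real.pi, Φ t : V) : C(closedBall (0 : Fin d → ℂ) 1, ℂ)) := by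
      ext z
      let L : V →L[ℂ] ℂ := (ContinuousMap.evalCLM ℂ z).comp V.subtypeL
      have h1 : L (∫ t in (0 : ℝ)..2 * Real.pi, Φ t) = ∫ t in (0 : ℝ)..2 * Real.pi, L (Φ t) :=
        (L.intervalIntegral_comp_comm (hΦ.intervalIntegrable _ _)).symm
      change f z = L (∫ t in (0 : ℝ)..2 * Real.pi, Φ t)
      have hz : z.1 j ∈ ball (0 : ℂ) r := by
        rw [mem_ball_zero_iff]
        exact ((norm_le_pi_norm z.1 j).trans (mem_closedBall_zero_iff.1 z.2)).trans_lt hr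
      have hd : DifferentiableOn ℂ (fun ζ => F (Function.update (s.piecewise z.1 w) j ζ))
          (closedBall 0 r) := fun ζ hζ =>
        ((hF _ (update_mem_closedBall (hpw z) j (mem_closedBall_zero_iff.1 hζ))).comp ζ
          (differentiable_update _ j ζ)).differentiableWithinAt
      have h2 := hd.circleIntegral_sub_inv_smul hz
      have h3 : (2 * Real.pi * Complex.I : ℂ) ≠ 0 := by simp [Real.pi_ne_zero]
      have h4 := (inv_smul_eq_iff₀ h3).2 h2
      rw [h1, hf, Finset.piecewise_insert, ← h4, circleIntegral, ← intervalIntegral.integral_smul]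
      rfl
    rw [hfΦ]
    exact (∫ t in (0 : ℝ)..2 * Real.pi, Φ t : V).2

/-- A function holomorphic near the closed polydisc is a uniform limit of polynomials on it. -/
theorem mem_polydiscAlgebra_of_differentiableAt {F : (Fin d → ℂ) → ℂ} {r : ℝ} (hr : 1 < r)
    (hF : ∀ z ∈ closedBall 0 r, DifferentiableAt ℂ F z)
    {f : C(closedBall (0 : Fin d → ℂ) 1, ℂ)} (hf : ∀ z, f z = F z.1) : f ∈ polydiscAlgebra d :=
  partial_mem_polydiscAlgebra hr hF Finset.univ 0 (by simp; linarith) f fun z => by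
    rw [hf, Finset.piecewise_univ]

/-- A continuous function on the closed polydisc that is holomorphic in the interior is a uniform
limit of polynomials. -/
theorem mem_polydiscAlgebra_of_differentiableOn {g : (Fin d → ℂ) → ℂ}
    (hg : DifferentiableOn ℂ g (ball 0 1)) {f : C(closedBall (0 : Fin d → ℂ) 1, ℂ)}
    (hf : ∀ z, z.1 ∈ ball (0 : Fin d → ℂ) 1 → f z = g z.1) : f ∈ polydiscAlgebra d := by
  have hmem : ∀ p : ℝ × closedBall (0 : Fin d → ℂ) 1,
      (((max 0 (min p.1 1) : ℝ) : ℂ) • p.2.1) ∈ closedBall (0 : Fin d → ℂ) 1 := by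
    intro p
    have h1 : ‖((max 0 (min p.1 1) : ℝ) : ℂ)‖ ≤ 1 := by
      rw [Complex.norm_real, Real.norm_eq_abs, abs_of_nonneg (le_max_left _ _)]
      exact max_le zero_le_one (min_le_right _ _)
    rw [mem_closedBall_zero_iff, norm_smul]
    exact mul_le_one₀ h1 (norm_nonneg _) (mem_closedBall_zero_iff.1 p.2.2)
  -- The dilates `f (ρ z)`, with `ρ` clamped to `[0, 1]` to be defined for all real parameters.
  -- Continuity of the curried map gives uniform convergence to `f` as `ρ → 1`.
  let Ψ : C(ℝ × closedBall (0 : Fin d → ℂ) 1, ℂ) :=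
    { toFun := fun p => f ⟨_, hmem p⟩
      continuous_toFun := by
        have h1 : Continuous fun p : ℝ × closedBall (0 : Fin d → ℂ) 1 =>
            ((max 0 (min p.1 1) : ℝ) : ℂ) := by fun_prop
        have h2 := h1.smul (continuous_subtype_val.comp continuous_snd)
        exact (map_continuous f).comp (h2.subtype_mk hmem) }
  have hΨ1 : Ψ.curry 1 = f := by
    ext z
    change f _ = f z
    congr 1
    ext i
    simp
  have hlim : Tendsto Ψ.curry (𝓝[<] 1) (𝓝 f) := by
    have := (map_continuous Ψ.curry).tendsto 1
    rw [hΨ1] at this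
    exact this.mono_left nhdsWithin_le_nhds
  refine isClosed_polydiscAlgebra.mem_of_tendsto hlim ?_
  filter_upwards [Ioo_mem_nhdsLT (zero_lt_one (α := ℝ))] with ρ hρ
  -- With `1 < c < ρ⁻¹`, the dilate `g (ρ z)` is holomorphic near the closed ball of radius `c`.
  obtain ⟨c, hc1, hc2⟩ := exists_between (one_lt_inv_iff₀.2 hρ)
  have hball : ∀ z ∈ closedBall (0 : Fin d → ℂ) c, ((ρ : ℂ) • z) ∈ ball (0 : Fin d → ℂ) 1 := by
    intro z hz
    rw [mem_ball_zero_iff, norm_smul, Complex.norm_real, Real.norm_eq_abs, abs_of_pos hρ.1]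
    rw [mem_closedBall_zero_iff] at hz
    calc ρ * ‖z‖ ≤ ρ * c := mul_le_mul_of_nonneg_left hz hρ.1.le
      _ < ρ * ρ⁻¹ := mul_lt_mul_of_pos_left hc2 hρ.1
      _ = 1 := mul_inv_cancel₀ hρ.1.ne'
  refine mem_polydiscAlgebra_of_differentiableAt (F := fun z => g ((ρ : ℂ) • z)) hc1
    (fun z hz => ?_) fun z => ?_
  · have h1 : DifferentiableAt ℂ g ((ρ : ℂ) • z) := hg.differentiableAt (isOpen_ball.mem_nhds (hball z hz))
    exact h1.comp z (by fun_prop)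
  · have h1 : max 0 (min ρ 1) = ρ := by rw [min_eq_left hρ.2.le, max_eq_right hρ.1.le]
    have h2 : (((max 0 (min ρ 1) : ℝ) : ℂ) • z.1) = (ρ : ℂ) • z.1 := by rw [h1]
    rw [← h2]
    refine hf _ ?_
    simp only [h2]
    exact hball _ (closedBall_subset_closedBall hc1.le z.2)

theorem differentiable_mvPolynomial_eval (q : MvPolynomial (Fin d) ℂ) :
    Differentiable ℂ fun x : Fin d → ℂ => MvPolynomial.eval x q := by
  induction q using MvPolynomial.induction_on with
  | C a => simp
  | add p q hp hq =>
    simp only [map_add]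
    exact hp.add hq
  | mul_X p i hp =>
    simp only [map_mul, MvPolynomial.eval_X]
    exact hp.mul (differentiable_apply i)

/-- One-variable maximum modulus moves the coordinates to the unit circle one at a time without
decreasing the modulus. -/
theorem exists_torus_eval_ge (q : MvPolynomial (Fin d) ℂ) (z : Fin d → ℂ)
    (hz : z ∈ closedBall (0 : Fin d → ℂ) 1) (s : Finset (Fin d)) :
    ∃ y ∈ closedBall (0 : Fin d → ℂ) 1, (∀ i ∈ s, ‖y i‖ = 1) ∧
      ‖MvPolynomial.eval z q‖ ≤ ‖MvPolynomial.eval y q‖ := by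
  induction s using Finset.induction_on with
  | empty => exact ⟨z, hz, by simp, le_rfl⟩
  | insert j s hj ih =>
    obtain ⟨y, hy, hys, hyq⟩ := ih
    have hd : Differentiable ℂ fun ζ : ℂ => MvPolynomial.eval (Function.update y j ζ) q := by
      exact (differentiable_mvPolynomial_eval q).comp (differentiable_update y j)
    obtain ⟨ζ, hζ, hmax⟩ := Complex.exists_mem_frontier_isMaxOn_norm (U := ball (0 : ℂ) 1)
      isBounded_ball ⟨0, by simp⟩ hd.diffContOnCl
    rw [frontier_ball _ one_ne_zero, mem_sphere_zero_iff_norm] at hζ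
    refine ⟨Function.update y j ζ, update_mem_closedBall hy j hζ.le, fun i hi => ?_, ?_⟩
    · rcases Finset.mem_insert.1 hi with rfl | hi
      · simpa using hζ
      · have : i ≠ j := fun h => hj (h ▸ hi)
        simpa [this] using hys i hi
    · refine hyq.trans ?_
      have h1 : y j ∈ closure (ball (0 : ℂ) 1) := by
        rw [closure_ball _ one_ne_zero, mem_closedBall_zero_iff]
        exact (norm_le_pi_norm y j).trans (mem_closedBall_zero_iff.1 hy)
      have h2 := hmax h1
      simpa using h2

/-- The maximum principle: the torus is a boundary for the polydisc algebra. -/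
theorem norm_le_of_norm_le_torus {f : C(closedBall (0 : Fin d → ℂ) 1, ℂ)}
    (hf : f ∈ polydiscAlgebra d) {c : ℝ}
    (hc : ∀ y : closedBall (0 : Fin d → ℂ) 1, (∀ i, ‖y.1 i‖ = 1) → ‖f y‖ ≤ c)
    (z : closedBall (0 : Fin d → ℂ) 1) : ‖f z‖ ≤ c := by
  refine le_of_forall_pos_le_add fun ε hε => ?_
  obtain ⟨q, hq⟩ := exists_polynomial_near hf (half_pos hε)
  obtain ⟨y, hy, hyT, hle⟩ := exists_torus_eval_ge q z.1 z.2 Finset.univ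
  have h1 := hq z
  have h2 := hq ⟨y, hy⟩
  have h3 := hc ⟨y, hy⟩ fun i => hyT i (Finset.mem_univ i)
  have h4 : ‖f z‖ ≤ ‖f z - MvPolynomial.eval z.1 q‖ + ‖MvPolynomial.eval z.1 q‖ := by
    simpa using norm_add_le (f z - MvPolynomial.eval z.1 q) (MvPolynomial.eval z.1 q)
  have h5 : ‖MvPolynomial.eval y q‖ ≤ ‖f ⟨y, hy⟩ - MvPolynomial.eval y q‖ + ‖f ⟨y, hy⟩‖ := by
    rw [norm_sub_rev]
    simpa using norm_add_le (MvPolynomial.eval y q - f ⟨y, hy⟩) (f ⟨y, hy⟩)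
  linarith

end Polydisc

/-! ### Linear automorphisms of the polydisc and averaging over the group -/

section ReflectionGroup

open Metric ComplexConjugate

variable {d : ℕ}

theorem polydisc_eq_ball (d : ℕ) : polydisc d = ball 0 1 := by
  ext z
  rw [mem_ball_zero_iff, pi_norm_lt_iff zero_lt_one]
  rfl

theorem norm_map_le_of_image_polydisc {σ : (Fin d → ℂ) ≃ₗ[ℂ] (Fin d → ℂ)}
    (h : σ '' polydisc d = polydisc d) (z : Fin d → ℂ) : ‖σ z‖ ≤ ‖z‖ := by
  rw [polydisc_eq_ball] at h
  refine le_of_forall_gt_imp_ge_of_dense fun r hr => ?_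
  have hr0 : 0 < r := (norm_nonneg z).trans_lt hr
  have h1 : ((r : ℂ)⁻¹ • z) ∈ ball (0 : Fin d → ℂ) 1 := by
    rw [mem_ball_zero_iff, norm_smul, norm_inv, Complex.norm_real, Real.norm_eq_abs,
      abs_of_pos hr0, inv_mul_lt_iff₀ hr0, mul_one]
    exact hr
  have h2 : σ ((r : ℂ)⁻¹ • z) ∈ ball (0 : Fin d → ℂ) 1 := h ▸ Set.mem_image_of_mem σ h1
  rw [map_smul, mem_ball_zero_iff, norm_smul, norm_inv, Complex.norm_real, Real.norm_eq_abs,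
    abs_of_pos hr0, inv_mul_lt_iff₀ hr0, mul_one] at h2
  exact h2.le

/-- A linear isometry of the supremum norm is a monomial matrix with unimodular entries. -/
theorem exists_perm_of_norm_map {σ : (Fin d → ℂ) ≃ₗ[ℂ] (Fin d → ℂ)} (h : ∀ z, ‖σ z‖ = ‖z‖) :
    ∃ (π : Equiv.Perm (Fin d)) (a : Fin d → ℂ), (∀ j, ‖a j‖ = 1) ∧
      ∀ z j, σ z (π j) = a j * z j := by
  let a : Fin d → Fin d → ℂ := fun i j => σ (Pi.single j 1) i
  have hsingle : ∀ j x, σ (Pi.single j x) = x • σ (Pi.single j 1) := fun j x => by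
    rw [← map_smul, ← Pi.single_smul, smul_eq_mul, mul_one]
  have ha : ∀ i j, ‖a i j‖ ≤ 1 := fun i j => by
    refine (norm_le_pi_norm (σ (Pi.single j 1)) i).trans ?_
    rw [h, Pi.norm_single, norm_one]
  have hex : ∀ j, ∃ i, ‖a i j‖ = 1 := by
    intro j
    by_contra! hne
    have h1 : ‖σ (Pi.single j 1)‖ < 1 := (pi_norm_lt_iff zero_lt_one).2 fun i =>
      lt_of_le_of_ne (ha i j) (hne i)
    rw [h, Pi.norm_single, norm_one] at h1
    exact lt_irrefl _ h1
  choose π hπ using hex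
  have hrow : ∀ j k, k ≠ j → a (π j) k = 0 := by
    intro j k hk
    -- A test vector of norm at most one whose image has coordinate `1 + |a (π j) k|²`; the isometry
    -- forces that entry to vanish.
    let z : Fin d → ℂ := Pi.single j (conj (a (π j) j)) + Pi.single k (conj (a (π j) k))
    have hz : ‖z‖ ≤ 1 := by
      rw [pi_norm_le_iff_of_nonneg zero_le_one]
      intro i
      by_cases hij : i = j
      · subst hij
        simp [z, hk.symm, hπ]
      · by_cases hik : i = k
        · subst hik
          simpa [z, hk] using ha (π j) i
        · simp [z, hij, hik]
    have hσz : σ z (π j) = ((1 + ‖a (π j) k‖ ^ 2 : ℝ) : ℂ) := by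
      have h1 : σ z (π j) = conj (a (π j) j) * a (π j) j + conj (a (π j) k) * a (π j) k := by
        rw [map_add, hsingle j, hsingle k]
        rfl
      rw [h1, Complex.conj_mul', Complex.conj_mul', hπ]
      push_cast
      ring
    have h2 : ‖σ z (π j)‖ ≤ 1 := (norm_le_pi_norm _ _).trans ((h z).trans_le hz)
    rw [hσz, Complex.norm_real, Real.norm_eq_abs, abs_of_nonneg (by positivity)] at h2
    have h3 : ‖a (π j) k‖ ^ 2 ≤ 0 := by linarith
    exact norm_eq_zero.1 (pow_eq_zero_iff two_ne_zero |>.1 (le_antisymm h3 (by positivity)))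
  have hinj : Function.Injective π := by
    intro j k hjk
    by_contra hne
    have h1 := hπ k
    rw [← hjk, hrow j k (Ne.symm hne), norm_zero] at h1
    exact zero_ne_one h1
  refine ⟨Equiv.ofBijective π (Finite.injective_iff_bijective.1 hinj), fun j => a (π j) j, hπ,
    fun z j => ?_⟩
  have hz : z = ∑ k, Pi.single k (z k) := (Finset.univ_sum_single z).symm
  rw [Equiv.ofBijective_apply]
  conv_lhs => rw [hz, map_sum, Finset.sum_apply]
  rw [Finset.sum_eq_single j]
  · rw [hsingle, Pi.smul_apply, smul_eq_mul, mul_comm]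
  · intro k _ hk
    rw [hsingle, Pi.smul_apply, smul_eq_mul]
    exact mul_eq_zero_of_right _ (hrow j k hk)
  · simp

variable {G : Subgroup ((Fin d → ℂ) ≃ₗ[ℂ] (Fin d → ℂ))}

theorem norm_map_of_mem (hinv : ∀ σ ∈ G, σ '' polydisc d = polydisc d)
    {σ : (Fin d → ℂ) ≃ₗ[ℂ] (Fin d → ℂ)} (hσ : σ ∈ G) (z : Fin d → ℂ) : ‖σ z‖ = ‖z‖ := by
  refine le_antisymm (norm_map_le_of_image_polydisc (hinv σ hσ) z) ?_
  have h1 := norm_map_le_of_image_polydisc (hinv σ⁻¹ (inv_mem hσ)) (σ z)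
  have h2 : σ⁻¹ (σ z) = z := σ.symm_apply_apply z
  rwa [h2] at h1

theorem norm_apply_eq_one_of_mem (hinv : ∀ σ ∈ G, σ '' polydisc d = polydisc d)
    {σ : (Fin d → ℂ) ≃ₗ[ℂ] (Fin d → ℂ)} (hσ : σ ∈ G) {z : Fin d → ℂ} (hz : ∀ i, ‖z i‖ = 1)
    (i : Fin d) : ‖σ z i‖ = 1 := by
  obtain ⟨π, a, ha, h⟩ := exists_perm_of_norm_map (norm_map_of_mem hinv hσ)
  obtain ⟨j, rfl⟩ := π.surjective i
  rw [h, norm_mul, ha, hz, mul_one]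

/-- The `|G|`-th power of the product of the coordinates is invariant. -/
theorem prod_pow_card_map (hinv : ∀ σ ∈ G, σ '' polydisc d = polydisc d)
    {σ : (Fin d → ℂ) ≃ₗ[ℂ] (Fin d → ℂ)} (hσ : σ ∈ G) (z : Fin d → ℂ) :
    (∏ i, σ z i) ^ Nat.card G = (∏ i, z i) ^ Nat.card G := by
  obtain ⟨π, a, ha, h⟩ := exists_perm_of_norm_map (norm_map_of_mem hinv hσ)
  have h1 : ∀ z, ∏ i, σ z i = (∏ j, a j) * ∏ j, z j := fun z => by
    rw [← Equiv.prod_comp π, ← Finset.prod_mul_distrib]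
    exact Finset.prod_congr rfl fun j _ => h z j
  have h2 : ∀ (n : ℕ) z, ∏ i, (σ ^ n) z i = (∏ j, a j) ^ n * ∏ j, z j := by
    intro n
    induction n with
    | zero => intro z; simp
    | succ n ih =>
      intro z
      rw [pow_succ', LinearEquiv.mul_apply, h1, ih, pow_succ']
      ring
  have h3 : σ ^ Nat.card G = 1 := by
    have := pow_card_eq_one' (x := (⟨σ, hσ⟩ : G))
    exact congrArg Subtype.val this
  -- Evaluating `σ ^ |G| = 1` at the all-ones vector isolates the product of the entries `a j`.
  have h4 := h2 (Nat.card G) 1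
  rw [h3] at h4
  have h5 : (∏ j, a j) ^ Nat.card G = 1 := by simpa using h4.symm
  rw [h1, mul_pow, h5, one_mul]

theorem exists_eval_comp (σ : (Fin d → ℂ) ≃ₗ[ℂ] (Fin d → ℂ)) (q : MvPolynomial (Fin d) ℂ) :
    ∃ q' : MvPolynomial (Fin d) ℂ, ∀ z, MvPolynomial.eval z q' = MvPolynomial.eval (σ z) q := by
  induction q using MvPolynomial.induction_on with
  | C a => exact ⟨MvPolynomial.C a, fun z => by simp⟩
  | add p q hp hq =>
    obtain ⟨p', hp'⟩ := hp
    obtain ⟨q', hq'⟩ := hq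
    exact ⟨p' + q', fun z => by simp [hp', hq']⟩
  | mul_X p i hp =>
    obtain ⟨p', hp'⟩ := hp
    refine ⟨p' * ∑ j, MvPolynomial.X j * MvPolynomial.C (σ (Pi.single j 1) i), fun z => ?_⟩
    have h1 : σ z i = ∑ j, z j * σ (Pi.single j 1) i := by
      conv_lhs => rw [pi_eq_sum_univ' z, map_sum, Finset.sum_apply]
      refine Finset.sum_congr rfl fun j _ => ?_
      rw [map_smul, Pi.smul_apply, smul_eq_mul]
    simp [hp', h1]

theorem eval_aeval (θ : Fin d → MvPolynomial (Fin d) ℂ) (Q : MvPolynomial (Fin d) ℂ)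
    (z : Fin d → ℂ) :
    MvPolynomial.eval z (MvPolynomial.aeval θ Q) = MvPolynomial.eval (polyMap θ z) Q := by
  induction Q using MvPolynomial.induction_on with
  | C a => simp
  | add p q hp hq => rw [map_add, map_add, map_add, hp, hq]
  | mul_X p i hp =>
    rw [map_mul, map_mul, map_mul, hp, MvPolynomial.aeval_X, MvPolynomial.eval_X]
    rfl

theorem polyMap_map_of_mem {θ : Fin d → MvPolynomial (Fin d) ℂ} (hθ : IsBasicPolynomials G θ)
    {σ : (Fin d → ℂ) ≃ₗ[ℂ] (Fin d → ℂ)} (hσ : σ ∈ G) (z : Fin d → ℂ) :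
    polyMap θ (σ z) = polyMap θ z := by
  ext i
  have h1 := (hθ.2 (θ i)).1 (Algebra.subset_adjoin ⟨i, rfl⟩) ⟨σ, hσ⟩ z
  rw [MonoidHom.one_apply, Units.val_one, one_mul] at h1
  exact h1

/-- Averaging a polynomial over the group gives a polynomial in the basic polynomials; it
approximates an invariant function as well as the given one does. -/
theorem exists_average {θ : Fin d → MvPolynomial (Fin d) ℂ} [Finite G]
    (hθ : IsBasicPolynomials G θ) (q : MvPolynomial (Fin d) ℂ) :
    ∃ Q : MvPolynomial (Fin d) ℂ, ∀ (z : Fin d → ℂ) (c : ℂ) (ε : ℝ),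
      (∀ σ ∈ G, ‖c - MvPolynomial.eval (σ z) q‖ ≤ ε) →
        ‖c - MvPolynomial.eval (polyMap θ z) Q‖ ≤ ε := by
  have := Fintype.ofFinite G
  choose q' hq' using fun σ : G => exists_eval_comp σ.1 q
  have hcard : (0 : ℝ) < Fintype.card G := by exact_mod_cast Fintype.card_pos
  have hcard' : (Fintype.card G : ℂ) ≠ 0 := by exact_mod_cast Fintype.card_ne_zero
  let Q₀ : MvPolynomial (Fin d) ℂ := MvPolynomial.C (Fintype.card G : ℂ)⁻¹ * ∑ σ : G, q' σ
  have hQ₀ : ∀ z, MvPolynomial.eval z Q₀ =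
      (Fintype.card G : ℂ)⁻¹ * ∑ σ : G, MvPolynomial.eval (σ.1 z) q := fun z => by
    simp [Q₀, hq']
  have hinv : IsInvariantPoly G Q₀ := by
    intro τ z
    rw [hQ₀, hQ₀, MonoidHom.one_apply, Units.val_one, one_mul]
    congr 1
    exact Fintype.sum_equiv (Equiv.mulRight τ) _ _ fun σ => rfl
  have hmem := (hθ.2 Q₀).2 hinv
  rw [Algebra.adjoin_range_eq_range_aeval] at hmem
  obtain ⟨Q, hQ⟩ := hmem
  refine ⟨Q, fun z c ε hε => ?_⟩
  have hQ' : MvPolynomial.aeval θ Q = Q₀ := hQ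
  rw [← eval_aeval, hQ', hQ₀]
  have h1 : c - (Fintype.card G : ℂ)⁻¹ * ∑ σ : G, MvPolynomial.eval (σ.1 z) q =
      (Fintype.card G : ℂ)⁻¹ * ∑ σ : G, (c - MvPolynomial.eval (σ.1 z) q) := by
    rw [Finset.sum_sub_distrib, Finset.sum_const, Finset.card_univ, nsmul_eq_mul, mul_sub,
      inv_mul_cancel_left₀ hcard']
  rw [h1, norm_mul, norm_inv, Complex.norm_natCast, inv_mul_le_iff₀ hcard]
  refine (norm_sum_le _ _).trans ((Finset.sum_le_sum fun σ _ => hε σ.1 σ.2).trans ?_)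
  simp

/-- On the torus, the conjugate of a polynomial times a high power of the product of the
coordinates is a polynomial. -/
theorem exists_conj_reflection (q : MvPolynomial (Fin d) ℂ) :
    ∃ M₀ : ℕ, ∀ M ≥ M₀, ∃ q' : MvPolynomial (Fin d) ℂ, ∀ z : Fin d → ℂ, (∀ i, ‖z i‖ = 1) →
      MvPolynomial.eval z q' = (∏ i, z i) ^ M * conj (MvPolynomial.eval z q) := by
  induction q using MvPolynomial.induction_on with
  | C a =>
    exact ⟨0, fun M _ => ⟨(∏ i, MvPolynomial.X i) ^ M * MvPolynomial.C (conj a), fun z _ => by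
      simp [map_prod]⟩⟩
  | add p q hp hq =>
    obtain ⟨M₁, h₁⟩ := hp
    obtain ⟨M₂, h₂⟩ := hq
    refine ⟨max M₁ M₂, fun M hM => ?_⟩
    obtain ⟨p', hp'⟩ := h₁ M ((le_max_left _ _).trans hM)
    obtain ⟨q', hq'⟩ := h₂ M ((le_max_right _ _).trans hM)
    exact ⟨p' + q', fun z hz => by rw [map_add, hp' z hz, hq' z hz, map_add, map_add, mul_add]⟩
  | mul_X p j hp =>
    obtain ⟨M₁, h₁⟩ := hp
    -- One further factor `∏ zᵢ` absorbs `conj (z j)`, since `z j * conj (z j) = 1` on the torus.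
    refine ⟨M₁ + 1, fun M hM => ?_⟩
    obtain ⟨M, rfl⟩ : ∃ M', M = M' + 1 := ⟨M - 1, by omega⟩
    obtain ⟨p', hp'⟩ := h₁ M (by omega)
    refine ⟨p' * ∏ i ∈ Finset.univ.erase j, MvPolynomial.X i, fun z hz => ?_⟩
    have h2 : (∏ i, z i) * conj (z j) = ∏ i ∈ Finset.univ.erase j, z i := by
      rw [← Finset.mul_prod_erase _ _ (Finset.mem_univ j), mul_right_comm, Complex.mul_conj',
        hz j]
      simp
    rw [map_mul, hp' z hz, map_prod, map_mul, map_mul, MvPolynomial.eval_X, pow_succ]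
    simp only [MvPolynomial.eval_X]
    rw [← h2]
    ring

end ReflectionGroup

/-! ### The algebra of the quotient domain -/

section QuotientDomain

open Metric ComplexConjugate

variable {d : ℕ} (θ : Fin d → MvPolynomial (Fin d) ℂ)

theorem differentiable_polyMap : Differentiable ℂ (polyMap θ) :=
  differentiable_pi.2 fun i => differentiable_mvPolynomial_eval (θ i)

theorem closure_quotientDomain :
    closure (quotientDomain θ) = polyMap θ '' closedBall 0 1 := by
  have hc := (differentiable_polyMap θ).continuous
  rw [quotientDomain, polydisc_eq_ball]
  refine subset_antisymm (closure_minimal (Set.image_mono ball_subset_closedBall)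
    ((isCompact_closedBall 0 1).image hc).isClosed) ?_
  rw [← closure_ball (0 : Fin d → ℂ) one_ne_zero]
  exact image_closure_subset_closure_image hc

instance : CompactSpace (closure (quotientDomain θ)) := by
  rw [← isCompact_iff_compactSpace, closure_quotientDomain]
  exact (isCompact_closedBall 0 1).image (differentiable_polyMap θ).continuous

/-- The map from the closed polydisc onto the closure of the quotient domain. -/
noncomputable def quotientMap : C(closedBall (0 : Fin d → ℂ) 1, closure (quotientDomain θ)) where
  toFun z := ⟨polyMap θ z.1, closure_quotientDomain θ ▸ Set.mem_image_of_mem _ z.2⟩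
  continuous_toFun :=
    ((differentiable_polyMap θ).continuous.comp continuous_subtype_val).subtype_mk _

theorem quotientMap_surjective : Function.Surjective (quotientMap θ) := by
  rintro ⟨x, hx⟩
  have hx' := hx
  rw [closure_quotientDomain] at hx'
  obtain ⟨z, hz, rfl⟩ := hx'
  exact ⟨⟨z, hz⟩, rfl⟩

variable {θ}

theorem comp_quotientMap_mem (f : holAlgebra (quotientDomain θ)) :
    f.1.comp (quotientMap θ) ∈ polydiscAlgebra d := by
  obtain ⟨g, hg, hfg⟩ := f.2
  have hmaps : Set.MapsTo (polyMap θ) (ball 0 1) (quotientDomain θ) := by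
    rw [quotientDomain, polydisc_eq_ball]
    exact Set.mapsTo_image _ _
  exact mem_polydiscAlgebra_of_differentiableOn
    (hg.comp (differentiable_polyMap θ).differentiableOn hmaps) fun z hz => hfg _ (hmaps hz)

/-- The maximum principle for the algebra of the quotient domain. -/
theorem norm_le_of_norm_le_quotient_torus {f : holAlgebra (quotientDomain θ)} {c : ℝ}
    (hc : ∀ y : closedBall (0 : Fin d → ℂ) 1, (∀ i, ‖y.1 i‖ = 1) → ‖f.1 (quotientMap θ y)‖ ≤ c)
    (x : closure (quotientDomain θ)) : ‖f.1 x‖ ≤ c := by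
  obtain ⟨z, rfl⟩ := quotientMap_surjective θ x
  exact norm_le_of_norm_le_torus (comp_quotientMap_mem f) hc z

/-- The distinguished boundary of the polydisc. -/
def torusSet (d : ℕ) : Set (closedBall (0 : Fin d → ℂ) 1) := {y | ∀ i, ‖y.1 i‖ = 1}

theorem isCompact_torusSet : IsCompact (torusSet d) := by
  refine IsClosed.isCompact ?_
  have : torusSet d = ⋂ i, {y | ‖y.1 i‖ = 1} := by
    ext y
    simp [torusSet]
  rw [this]
  exact isClosed_iInter fun i => isClosed_eq
    ((continuous_apply i).comp continuous_subtype_val).norm continuous_const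

/-- The image of the torus is compact, and by the maximum principle every element of the algebra
attains its maximum modulus there. Only this inclusion is needed. -/
theorem quotientBoundary_subset : quotientBoundary θ ⊆ quotientMap θ '' torusSet d := by
  have hK : IsCompact (quotientMap θ '' torusSet d) :=
    isCompact_torusSet.image (map_continuous (quotientMap θ))
  refine Set.sInter_subset_of_mem ⟨hK.isClosed, fun f hf => ?_⟩
  have hne : (quotientMap θ '' torusSet d).Nonempty :=
    ⟨_, ⟨⟨fun _ => 1, by rw [mem_closedBall_zero_iff, pi_norm_le_iff_of_nonneg zero_le_one]; simp⟩,
      fun i => by simp, rfl⟩⟩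
  obtain ⟨y, hy, hmax⟩ := hK.exists_isMaxOn hne (map_continuous f).norm.continuousOn
  exact ⟨y, hy, norm_le_of_norm_le_quotient_torus (f := ⟨f, hf⟩) fun z hz =>
    hmax (Set.mem_image_of_mem _ hz)⟩

instance : CompactSpace (quotientBoundary θ) :=
  isCompact_iff_compactSpace.1 (isClosed_sInter fun _ hE => hE.1).isCompact

variable (θ) in
/-- The coordinate functions on the quotient domain. -/
noncomputable def quotientCoord (i : Fin d) : holAlgebra (quotientDomain θ) :=
  ⟨⟨fun x => x.1 i, (continuous_apply i).comp continuous_subtype_val⟩, fun x => x i,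
    (differentiable_apply i).differentiableOn, fun _ _ => rfl⟩

theorem aeval_quotientCoord_apply (Q : MvPolynomial (Fin d) ℂ) (x : closure (quotientDomain θ)) :
    (MvPolynomial.aeval (quotientCoord θ) Q).1 x = MvPolynomial.eval x.1 Q := by
  induction Q using MvPolynomial.induction_on with
  | C a =>
    rw [MvPolynomial.aeval_C, MvPolynomial.eval_C]
    rfl
  | add p q hp hq =>
    rw [map_add, map_add, ← hp, ← hq]
    rfl
  | mul_X p i hp =>
    rw [map_mul, map_mul, MvPolynomial.aeval_X, MvPolynomial.eval_X, ← hp]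
    rfl

/-- A nowhere vanishing element of the algebra is invertible. -/
theorem exists_inverse_of_ne_zero (a : holAlgebra (quotientDomain θ)) (ha : ∀ x, a.1 x ≠ 0) :
    ∃ b : holAlgebra (quotientDomain θ), ∀ x, b.1 x = (a.1 x)⁻¹ := by
  obtain ⟨g, hg, hag⟩ := a.2
  refine ⟨⟨⟨fun x => (a.1 x)⁻¹, (map_continuous a.1).inv₀ ha⟩, fun x => (g x)⁻¹, ?_, ?_⟩,
    fun x => rfl⟩
  · refine hg.inv fun x hx => ?_
    rw [← hag x hx]
    exact ha _
  · intro x hx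
    change (a.1 _)⁻¹ = _
    rw [hag x hx]

theorem norm_holAlgebra_le {f : holAlgebra (quotientDomain θ)} {c : ℝ} (hc0 : 0 ≤ c)
    (hc : ∀ x, ‖f.1 x‖ ≤ c) : ‖f‖ ≤ c :=
  (ContinuousMap.norm_le f.1 hc0).2 hc

variable {G : Subgroup ((Fin d → ℂ) ≃ₗ[ℂ] (Fin d → ℂ))}

/-- The polynomials are dense in the algebra of the quotient domain. -/
theorem holAlgebra_mem_closure_range [Finite G] (hinv : ∀ σ ∈ G, σ '' polydisc d = polydisc d)
    (hθ : IsBasicPolynomials G θ) (f : holAlgebra (quotientDomain θ)) :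
    f ∈ closure ((MvPolynomial.aeval (R := ℂ) (quotientCoord θ)).range :
      Set (holAlgebra (quotientDomain θ))) := by
  rw [Metric.mem_closure_iff]
  intro ε hε
  obtain ⟨q, hq⟩ := exists_polynomial_near (comp_quotientMap_mem f) (half_pos hε)
  obtain ⟨Q, hQ⟩ := exists_average hθ q
  refine ⟨_, ⟨Q, rfl⟩, lt_of_le_of_lt ?_ (half_lt_self hε)⟩
  rw [dist_eq_norm]
  refine norm_holAlgebra_le (half_pos hε).le fun x => ?_
  obtain ⟨z, rfl⟩ := quotientMap_surjective θ x
  change ‖f.1 (quotientMap θ z) - (MvPolynomial.aeval (quotientCoord θ) Q).1 (quotientMap θ z)‖ ≤ _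
  rw [aeval_quotientCoord_apply]
  refine hQ z.1 _ _ fun σ hσ => ?_
  have hσz : σ z.1 ∈ closedBall (0 : Fin d → ℂ) 1 := by
    rw [mem_closedBall_zero_iff, norm_map_of_mem hinv hσ]
    exact mem_closedBall_zero_iff.1 z.2
  have h1 : quotientMap θ z = quotientMap θ ⟨σ z.1, hσz⟩ :=
    Subtype.ext (polyMap_map_of_mem hθ hσ z.1).symm
  rw [h1]
  exact hq ⟨σ z.1, hσz⟩

variable (θ) in
/-- The inner functions: the elements of the algebra that are unimodular on the image of the
torus. -/
def innerMonoid : Submonoid (holAlgebra (quotientDomain θ)) where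
  carrier := {f | ∀ y ∈ torusSet d, ‖f.1 (quotientMap θ y)‖ = 1}
  mul_mem' := fun {f g} hf hg y hy => by
    change ‖f.1 (quotientMap θ y) * g.1 (quotientMap θ y)‖ = 1
    rw [norm_mul, hf y hy, hg y hy, mul_one]
  one_mem' := fun y _ => by
    change ‖(1 : ℂ)‖ = 1
    exact norm_one

theorem norm_le_one_of_mem_innerMonoid {f : holAlgebra (quotientDomain θ)}
    (hf : f ∈ innerMonoid θ) : ‖f‖ ≤ 1 :=
  norm_holAlgebra_le zero_le_one (norm_le_of_norm_le_quotient_torus fun y hy => (hf y hy).le)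

end QuotientDomain

/-! ### Generation of the algebra by inner functions -/

theorem mem_of_perturbed_mul_mem {A : Type*} [NormedCommRing A] [NormedAlgebra ℂ A]
    {B : Set A} (hB : IsClosed B) {k w : A} {δ : ℝ} (hδ : 0 < δ)
    (h : ∀ t : ℝ, 0 < t → t < δ → ∃ v : A, v * (1 + (t : ℂ) • w) = 1 ∧ ‖v‖ ≤ 2 ∧ k * v ∈ B) :
    k ∈ B := by
  rw [← hB.closure_eq, Metric.mem_closure_iff]
  intro ε hε
  let C := 2 * (‖k‖ * ‖w‖) + 1
  have hC : 0 < C := by positivity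
  let t := min (δ / 2) (ε / (2 * C))
  have ht : 0 < t := lt_min (half_pos hδ) (by positivity)
  obtain ⟨v, hv, hv2, hkv⟩ := h t ht ((min_le_left _ _).trans_lt (half_lt_self hδ))
  refine ⟨k * v, hkv, ?_⟩
  -- Since `v` inverts `1 + t w`, the error `k - k v = t k w v` is of order `t`, and `k` is a limit
  -- of elements of `B`.
  have h1 : k - k * v = (t : ℂ) • (k * w * v) := by
    have : k = k * (v * (1 + (t : ℂ) • w)) := by rw [hv, mul_one]
    have h2 : (t : ℂ) • (k * w * v) = k * v * ((t : ℂ) • w) := by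
      rw [mul_smul_comm]
      congr 1
      ring
    rw [h2]
    nth_rewrite 1 [this]
    ring
  rw [dist_eq_norm, h1, norm_smul, Complex.norm_real, Real.norm_eq_abs, abs_of_pos ht]
  have h3 : ‖k * w * v‖ ≤ ‖k‖ * ‖w‖ * 2 :=
    (norm_mul_le _ _).trans (mul_le_mul (norm_mul_le _ _) hv2 (norm_nonneg _) (by positivity))
  calc t * ‖k * w * v‖ ≤ t * C := mul_le_mul_of_nonneg_left (by simp only [C]; linarith) ht.le
    _ ≤ ε / (2 * C) * C := mul_le_mul_of_nonneg_right (min_le_right _ _) hC.le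
    _ = ε / 2 := by field_simp
    _ < ε := half_lt_self hε

section Generation

open Metric ComplexConjugate

variable {d : ℕ} {θ : Fin d → MvPolynomial (Fin d) ℂ}
  {G : Subgroup ((Fin d → ℂ) ≃ₗ[ℂ] (Fin d → ℂ))}

/-- For every coordinate function `c` there are elements `u`, `w` of the algebra such that, on the
image of the torus, `u` is unimodular and `w` is `u` times the conjugate of `c`. -/
theorem exists_unimodular_reflection [Finite G] (hinv : ∀ σ ∈ G, σ '' polydisc d = polydisc d)
    (hθ : IsBasicPolynomials G θ) (i : Fin d) :
    ∃ u w : holAlgebra (quotientDomain θ), ∀ y ∈ torusSet d,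
      ‖u.1 (quotientMap θ y)‖ = 1 ∧ w.1 (quotientMap θ y) =
        u.1 (quotientMap θ y) * conj ((quotientCoord θ i).1 (quotientMap θ y)) := by
  obtain ⟨M₀, hM₀⟩ := exists_conj_reflection (θ i)
  have hcard : 0 < Nat.card G := Nat.card_pos
  -- The exponent is a multiple of `|G|` to make the power of `∏ zᵢ` invariant, and at least `M₀` to
  -- make its product with `conj (θ i)` a polynomial on the torus.
  obtain ⟨q, hq⟩ := hM₀ (Nat.card G * M₀) (Nat.le_mul_of_pos_left _ hcard)
  have hpow : ∀ σ ∈ G, ∀ z, (∏ i, σ z i) ^ (Nat.card G * M₀) = (∏ i, z i) ^ (Nat.card G * M₀) :=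
    fun σ hσ z => by rw [pow_mul, prod_pow_card_map hinv hσ, pow_mul]
  obtain ⟨U, hU⟩ := exists_average hθ ((∏ i, MvPolynomial.X i) ^ (Nat.card G * M₀))
  obtain ⟨W, hW⟩ := exists_average hθ q
  have hU' : ∀ z, MvPolynomial.eval (polyMap θ z) U = (∏ i, z i) ^ (Nat.card G * M₀) := fun z => by
    have h1 := hU z ((∏ i, z i) ^ (Nat.card G * M₀)) 0 fun σ hσ => by
      simp [map_prod, hpow σ hσ z]
    exact (sub_eq_zero.1 (norm_le_zero_iff.1 h1)).symm
  refine ⟨MvPolynomial.aeval (quotientCoord θ) U, MvPolynomial.aeval (quotientCoord θ) W,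
    fun y hy => ?_⟩
  have hy' : ∀ i, ‖y.1 i‖ = 1 := hy
  have hW' : MvPolynomial.eval (polyMap θ y.1) W =
      (∏ i, y.1 i) ^ (Nat.card G * M₀) * conj (polyMap θ y.1 i) := by
    -- On the torus `q` takes the same value along each `G`-orbit, so averaging with error `ε = 0`
    -- reproduces it exactly.
    have h1 := hW y.1 ((∏ i, y.1 i) ^ (Nat.card G * M₀) * conj (polyMap θ y.1 i)) 0 fun σ hσ => by
      rw [hq _ (norm_apply_eq_one_of_mem hinv hσ hy'), hpow σ hσ]
      have h2 : MvPolynomial.eval (σ y.1) (θ i) = polyMap θ y.1 i :=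
        congrFun (polyMap_map_of_mem hθ hσ y.1) i
      rw [h2, sub_self, norm_zero]
    exact (sub_eq_zero.1 (norm_le_zero_iff.1 h1)).symm
  rw [aeval_quotientCoord_apply, aeval_quotientCoord_apply]
  have h3 : (quotientMap θ y).1 = polyMap θ y.1 := rfl
  rw [h3, hU', hW']
  refine ⟨?_, rfl⟩
  rw [norm_pow, norm_prod]
  simp [hy']

/-- The Möbius type combination `(l c + u) (1 + conj l w)⁻¹` is inner. -/
theorem exists_inner_moebius {c u w : holAlgebra (quotientDomain θ)}
    (h : ∀ y ∈ torusSet d, ‖u.1 (quotientMap θ y)‖ = 1 ∧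
      w.1 (quotientMap θ y) = u.1 (quotientMap θ y) * conj (c.1 (quotientMap θ y)))
    {l : ℂ} (hl : ‖l‖ * ‖w‖ ≤ 1 / 2) :
    ∃ v : holAlgebra (quotientDomain θ), v * (1 + conj l • w) = 1 ∧ ‖v‖ ≤ 2 ∧
      (l • c + u) * v ∈ innerMonoid θ := by
  let a : holAlgebra (quotientDomain θ) := 1 + conj l • w
  have hax : ∀ x, a.1 x = 1 + conj l * w.1 x := fun x => rfl
  have hlow : ∀ x, 1 / 2 ≤ ‖a.1 x‖ := fun x => by
    have h1 : ‖conj l * w.1 x‖ ≤ 1 / 2 := by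
      rw [norm_mul, RCLike.norm_conj]
      exact (mul_le_mul_of_nonneg_left (ContinuousMap.norm_coe_le_norm w.1 x)
        (norm_nonneg _)).trans hl
    have h2 : ‖(1 : ℂ)‖ ≤ ‖a.1 x‖ + ‖conj l * w.1 x‖ := by
      have := norm_sub_le (a.1 x) (conj l * w.1 x)
      rwa [hax, add_sub_cancel_right] at this
    rw [norm_one] at h2
    linarith
  have ha0 : ∀ x, a.1 x ≠ 0 := fun x => norm_pos_iff.1 (lt_of_lt_of_le (by norm_num) (hlow x))
  obtain ⟨v, hv⟩ := exists_inverse_of_ne_zero a ha0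
  refine ⟨v, ?_, ?_, fun y hy => ?_⟩
  · refine Subtype.ext (ContinuousMap.ext fun x => ?_)
    change v.1 x * a.1 x = 1
    rw [hv, inv_mul_cancel₀ (ha0 x)]
  · refine norm_holAlgebra_le zero_le_two fun x => ?_
    rw [hv, norm_inv]
    exact (inv_anti₀ (by norm_num) (hlow x)).trans (by norm_num)
  · obtain ⟨hu, hw⟩ := h y hy
    set x := quotientMap θ y
    change ‖(l * c.1 x + u.1 x) * v.1 x‖ = 1
    -- On the torus the denominator is `u` times the conjugate of the numerator, so the two have
    -- equal modulus.
    have h1 : a.1 x = u.1 x * conj (l * c.1 x + u.1 x) := by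
      have h2 : u.1 x * conj (u.1 x) = 1 := by
        rw [Complex.mul_conj', hu]
        simp
      rw [hax, hw, map_add, map_mul, mul_add, h2]
      ring
    have h3 : ‖a.1 x‖ = ‖l * c.1 x + u.1 x‖ := by
      rw [h1, norm_mul, hu, one_mul, RCLike.norm_conj]
    rw [norm_mul, hv, norm_inv, ← h3, mul_inv_cancel₀ (norm_ne_zero_iff.2 (ha0 x))]

/-- With `l = t ω`, the inner quotient is `u + t (ω c - conj ω u w) + O(t²)`. The linear coefficient
therefore lies in every closed subalgebra containing the inner elements, and two values of `ω`
separate `c` from `u w`. Density of the polynomials finishes. -/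
theorem innerMonoid_generates [Finite G] (hinv : ∀ σ ∈ G, σ '' polydisc d = polydisc d)
    (hθ : IsBasicPolynomials G θ) :
    HilbertModule.TopologicallyGenerates (innerMonoid θ) := by
  intro B hB hSB
  have hcoord : ∀ i, quotientCoord θ i ∈ B := by
    intro i
    obtain ⟨u, w, h⟩ := exists_unimodular_reflection hinv hθ i
    set c := quotientCoord θ i
    have huB : u ∈ B := hSB fun y hy => (h y hy).1
    have key : ∀ ω : ℂ, ‖ω‖ = 1 → ω • c - conj ω • (u * w) ∈ B := by
      intro ω hω
      -- This `δ` ensures `t ‖w‖ ≤ 1 / 2`, which keeps the denominator away from zero.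
      refine mem_of_perturbed_mul_mem hB (w := conj ω • w) (δ := 1 / (2 * (‖w‖ + 1)))
        (by positivity) fun t ht htδ => ?_
      have hl : ‖(t : ℂ) * ω‖ * ‖w‖ ≤ 1 / 2 := by
        rw [norm_mul, hω, mul_one, Complex.norm_real, Real.norm_eq_abs, abs_of_pos ht]
        rw [lt_div_iff₀ (by positivity)] at htδ
        nlinarith [norm_nonneg w]
      obtain ⟨v, hv1, hv2, hv3⟩ := exists_inner_moebius h hl
      have hconj : conj ((t : ℂ) * ω) • w = (t : ℂ) • conj ω • w := by
        rw [map_mul, Complex.conj_ofReal, mul_smul]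
      rw [hconj] at hv1
      refine ⟨v, hv1, hv2, ?_⟩
      -- Exact form of the difference quotient: write the subtracted `u` as `u v (1 + t conj ω w)`.
      have h1 : (t : ℂ) • ((ω • c - conj ω • (u * w)) * v) =
          (((t : ℂ) * ω) • c + u) * v - u := by
        have h2 : u = u * (v * (1 + (t : ℂ) • conj ω • w)) := by rw [hv1, mul_one]
        nth_rewrite 3 [h2]
        simp only [Algebra.smul_def, map_mul]
        ring
      have h3 : (t : ℂ) • ((ω • c - conj ω • (u * w)) * v) ∈ B := by
        rw [h1]
        exact B.sub_mem (hSB hv3) huB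
      have h4 := B.smul_mem h3 (t : ℂ)⁻¹
      rwa [inv_smul_smul₀ (by exact_mod_cast ht.ne')] at h4
    -- `ω = 1` gives `c - u w`; `ω = I`, multiplied by `-I`, gives `c + u w`. Half the sum is `c`.
    have h1 := key 1 (by simp)
    have h2 := B.smul_mem (key Complex.I (by simp)) (-Complex.I)
    have h3 := B.smul_mem (B.add_mem h1 h2) (1 / 2 : ℂ)
    have h4 : (1 / 2 : ℂ) • ((1 : ℂ) • c - conj (1 : ℂ) • (u * w) +
        (-Complex.I) • (Complex.I • c - conj Complex.I • (u * w))) = c := by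
      rw [map_one, Complex.conj_I, smul_sub, smul_smul, smul_smul]
      have e1 : -Complex.I * Complex.I = 1 := by simp
      have e2 : -Complex.I * -Complex.I = -1 := by simp
      rw [e1, e2]
      module
    rwa [h4] at h3
  rw [eq_top_iff]
  intro f _
  have h1 := holAlgebra_mem_closure_range hinv hθ f
  refine hB.closure_subset_iff.2 ?_ h1
  rintro _ ⟨Q, rfl⟩
  have h2 : (MvPolynomial.aeval (R := ℂ) (quotientCoord θ)).range ≤ B := by
    rw [← Algebra.adjoin_range_eq_range_aeval]
    refine Algebra.adjoin_le ?_
    rintro _ ⟨i, rfl⟩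
    exact hcoord i
  exact h2 ⟨Q, rfl⟩

end Generation

/-! ### Splitting of extensions -/

/-- The unit ball of a normed algebra acts boundedly on a Hilbert module. -/
theorem HilbertModule.exists_norm_actCLM_le {A : Type v} [NormedCommRing A] [NormedAlgebra ℂ A]
    (H : HilbertModule.{u} A) : ∃ C : ℝ, ∀ a : A, ‖a‖ ≤ 1 → ‖H.actCLM a‖ ≤ C := by
  -- For fixed `x` the orbit map `a ↦ a • x` is bounded and linear; uniform boundedness makes the
  -- estimate independent of `x`.
  obtain ⟨C, hC⟩ := banach_steinhaus (g := fun a : {a : A // ‖a‖ ≤ 1} => H.actCLM a.1) fun x => by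
    let L : A →L[ℂ] H :=
      { toFun := fun a => a • x
        map_add' := fun a b => add_smul a b x
        map_smul' := fun c a => smul_assoc c a x
        cont := continuous_id.smul continuous_const }
    exact ⟨‖L‖, fun a => (L.le_opNorm a.1).trans (mul_le_of_le_one_right (norm_nonneg _) a.2)⟩
  exact ⟨C, fun a ha => hC ⟨a, ha⟩⟩

section Splitting

variable {d : ℕ} {θ : Fin d → MvPolynomial (Fin d) ℂ}

theorem innerMonoid_actsBoundedly (H : HilbertModule.{u} (holAlgebra (quotientDomain θ))) :
    H.ActsBoundedly (innerMonoid θ) := by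
  obtain ⟨C, hC⟩ := H.exists_norm_actCLM_le
  exact ⟨C, fun s => hC s.1 (norm_le_one_of_mem_innerMonoid s.2)⟩

/-- An inner element is unimodular on the Šilov boundary, so its reciprocal is a contraction in
`C(∂θ(𝔻^d))`, which acts on `N` even when no inverse exists in `𝒜(θ(𝔻^d))`. -/
theorem innerMonoid_actsBoundedlyInvertibly (N : HilbertModule.{u} C(quotientBoundary θ, ℂ)) :
    (asQuotientModule θ N).ActsBoundedlyInvertibly (innerMonoid θ) := by
  obtain ⟨C, hC⟩ := N.exists_norm_actCLM_le
  have hone : ∀ (s : innerMonoid θ) (x : quotientBoundary θ),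
      ‖restrictToBoundary θ s.1 x‖ = 1 := by
    intro s x
    obtain ⟨y, hy, hyx⟩ := quotientBoundary_subset x.2
    change ‖s.1.1 x.1‖ = 1
    rw [← hyx]
    exact s.2 y hy
  have hne : ∀ (s : innerMonoid θ) (x : quotientBoundary θ), restrictToBoundary θ s.1 x ≠ 0 :=
    fun s x => norm_ne_zero_iff.1 (by rw [hone]; exact one_ne_zero)
  let inv : innerMonoid θ → C(quotientBoundary θ, ℂ) := fun s =>
    ⟨fun x => (restrictToBoundary θ s.1 x)⁻¹, (map_continuous _).inv₀ (hne s)⟩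
  have hinv : ∀ s, inv s * restrictToBoundary θ s.1 = 1 := fun s =>
    ContinuousMap.ext fun x => inv_mul_cancel₀ (hne s x)
  have hnorm : ∀ s, ‖inv s‖ ≤ 1 := fun s => (ContinuousMap.norm_le _ zero_le_one).2 fun x => by
    change ‖(restrictToBoundary θ s.1 x)⁻¹‖ ≤ 1
    rw [norm_inv, hone, inv_one]
  have hleft : ∀ s (x : N), inv s • restrictToBoundary θ s.1 • x = x := fun s x => by
    rw [smul_smul, hinv, one_smul]
  have hright : ∀ s (x : N), restrictToBoundary θ s.1 • inv s • x = x := fun s x => by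
    rw [smul_smul, mul_comm, hinv, one_smul]
  exact ⟨C, fun s => N.actCLM (inv s), fun s => hC _ (hnorm s), hleft, hright⟩

variable {G : Subgroup ((Fin d → ℂ) ≃ₗ[ℂ] (Fin d → ℂ))} {ℓ : MvPolynomial (Fin d) ℂ}

namespace NormalHilbertModule.Extension

variable {K H : NormalHilbertModule.{u} G θ ℓ}

/-- A retraction onto the kernel makes an extension equivalent to the split one. -/
theorem equivalent_split_of_retraction (E : Extension K H)
    (r : E.J →L[holAlgebra (quotientDomain θ)] H) (hr : ∀ x, r (E.α x) = x) :
    Equivalent E (split K H) := by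
  refine ⟨{ toFun := fun j => (WithLp.toLp 2 (r j, E.β j) : WithLp 2 (H × K))
            map_add' := fun x y => by rw [map_add, map_add]; rfl
            map_smul' := fun a x => by rw [map_smul, map_smul]; rfl
            cont := (WithLp.prod_continuous_toLp 2 H K).comp
              (r.continuous.prodMk E.β.continuous) }, fun h => ?_, fun j => rfl⟩
  change (WithLp.toLp 2 (r (E.α h), E.β (E.α h)) : WithLp 2 (H × K)) = WithLp.toLp 2 (h, 0)
  rw [hr, (E.exact _).2 ⟨h, rfl⟩]

/-- A split exact sequence is equivalent to the direct sum extension. -/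
theorem Splits.equivalent_split {E : Extension K H} (hE : E.Splits) :
    Equivalent E (split K H) := by
  obtain ⟨s, hs⟩ := hE
  refine Equivalent.symm ⟨{ toFun := fun x => E.α (WithLp.ofLp (p := 2) (V := H × K) x).1 +
                              s (WithLp.ofLp (p := 2) (V := H × K) x).2
                            map_add' := fun x y => ?_
                            map_smul' := fun a x => ?_
                            cont := ?_ }, fun h => ?_, fun x => ?_⟩
  · change E.α (_ + _) + s (_ + _) = _
    rw [map_add, map_add]
    exact add_add_add_comm _ _ _ _
  · change E.α (a • _) + s (a • _) = a • (_ + _)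
    rw [map_smul, map_smul, smul_add]
    rfl
  · have h1 := WithLp.prod_continuous_ofLp 2 H K
    exact (E.α.continuous.comp (continuous_fst.comp h1)).add
      (s.continuous.comp (continuous_snd.comp h1))
  · change E.α h + s 0 = E.α h
    rw [map_zero, add_zero]
  · change E.β (E.α (WithLp.ofLp (p := 2) (V := H × K) x).1 +
      s (WithLp.ofLp (p := 2) (V := H × K) x).2) = (WithLp.ofLp (p := 2) (V := H × K) x).2
    rw [map_add, (E.exact _).2 ⟨_, rfl⟩, zero_add, hs]

end NormalHilbertModule.Extension

end Splitting

theorem mainTheorem2 {d : ℕ} (hd : 1 < d)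
    (G : Subgroup ((Fin d → ℂ) ≃ₗ[ℂ] (Fin d → ℂ))) (hfin : Finite G)
    (hG : IsPseudoReflectionGroup G) (hinv : ∀ σ ∈ G, σ '' polydisc d = polydisc d)
    (θ : Fin d → MvPolynomial (Fin d) ℂ) (hθ : IsBasicPolynomials G θ)
    (ρ : G →* ℂˣ) (ℓ : MvPolynomial (Fin d) ℂ) (hℓ : IsRelInvariantGenerator ρ ℓ)
    (N : HilbertModule.{u} C(quotientBoundary θ, ℂ))
    (hN : (asQuotientModule θ N).IsNormal G θ ℓ) :
    (∀ K : NormalHilbertModule.{u} G θ ℓ,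
      (∀ e : NormalHilbertModule.Ext K (asNormalModule N hN), e = 0) ∧
      (∀ e : NormalHilbertModule.Ext (asNormalModule N hN) K, e = 0)) ∧
    (asNormalModule N hN).IsProjective := by
  have hS := innerMonoid_generates hinv hθ
  have hNS := innerMonoid_actsBoundedlyInvertibly N
  have hproj : (asNormalModule N hN).IsProjective := fun H E =>
    HilbertModule.exists_moduleMap_section hS (innerMonoid_actsBoundedly E.J.toHilbertModule) hNS
      E.β E.surjective
  refine ⟨fun K => ⟨fun e => ?_, fun e => ?_⟩, hproj⟩
  · induction e using Quotient.inductionOn with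
    | h E =>
      -- By exactness the range of `α` is the kernel of the continuous map `β`; closedness is what
      -- the retraction needs.
      have hr : IsClosed (Set.range E.α) := by
        have h1 : Set.range E.α = E.β ⁻¹' {0} := Set.ext fun x => (E.exact x).symm
        rw [h1]
        exact isClosed_singleton.preimage E.β.continuous
      obtain ⟨r, hr⟩ := HilbertModule.exists_moduleMap_retraction hS
        (innerMonoid_actsBoundedly E.J.toHilbertModule) hNS E.α E.injective hr
      exact Quotient.sound (E.equivalent_split_of_retraction r hr)
  · induction e using Quotient.inductionOn with
    | h E => exact Quotient.sound (hproj K E).equivalent_split
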